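/- Let $(X,\mu)$ be a $\sigma$-finite measure space and let $A$ be a non-negative self-adjoint operator on $L^2(X)$ (real or complex valued functions) with spectral resolution $E_A$; for a real Borel function $\phi$ write $\phi(A)=\int_{\sigma(A)}\phi(\lambda)\,dE_A(\lambda)$, with domain $\{f\in L^2(X):\int|\phi|^2\,d\|E_A(\lambda)f\|_{L^2}^2<\infty\}$. Assume that for some $\alpha>0$ $$\|e^{-tA}\|_{L^2\to L^\infty}\lesssim t^{-\alpha},\qquad t>0 .$$ For $r\ge 0$ let $H^r(A)$ be the domain of $(I+A)^{r/2}$ with the norm $\|f\|_{H^r(A)}=\|(I+A)^{r/2}f\|_{L^2}$, and let $H^{-r}(A)$ be the dual space of $H^r(A)$; for $r>0$, a function $f\in L^q(X)$, $1\le q\le 2$, belongs to $H^{-r}(A)$ if $g\mapsto\int_X f\bar g\,d\mu$, $g\in H^r(A)\cap L^\infty(X)$, extends to a bounded conjugate-linear functional on $H^r(A)$ (the extension is unique), and $\|f\|_{H^{-r}(A)}$ is the norm of that functional; the operators $\phi(A)$ act on $H^{-r}(A)$ by duality. Put $\langle t\rangle=(1+t^2)^{1/2}$ and $\mathcal D(t,A)=\int_{\sigma(A)}\mathcal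 D(t,\lambda)\,dE_A(\lambda)$ with $$\mathcal D(t,\lambda)=\begin{cases}\dfrac{e^{-t/2}\sinh\big(t\sqrt{1/4-\lambda}\big)}{\sqrt{1/4-\lambda}}&(0\le\lambda<\tfrac14),\\[2mm] t\,e^{-t/2}&(\lambda=\tfrac14),\\[1mm] \dfrac{e^{-t/2}\sin\big(t\sqrt{\lambda-1/4}\big)}{\sqrt{\lambda-1/4}}&(\lambda>\tfrac14).\end{cases}$$ Let $k\in\{0,1\}$, $q\in[1,2]$, $s\ge 0$ and $\beta>2\alpha+k+s-1$. Then the following estimates hold, with constants independent of $f$ and $t$; in them $A^{s/2}\mathcal D(t,A)f$ and $A^{s/2}(\mathcal D(t,A)-e^{-tA})f$ are well defined in $L^2(X)$ for all $t>0$, and the time derivative $\partial_t^k$ exists in $L^2(X)$. (i) For all $t>0$, $$\|\partial_t^kA^{\frac s2}\mathcal D(t,A)f\|_{L^\infty}\lesssim\langle t\rangle^{-\frac{2\alpha}{q}-k-\frac s2}\big(\|f\|_{L^q}+e^{-\frac t4}\|f\|_{H^\beta(A)}\big),\qquad f\in L^q(X)\cap H^\beta(A),$$ $$\|\partial_t^kA^{\frac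 s2}\mathcal D(t,A)f\|_{L^2}\lesssim\langle t\rangle^{-2\alpha(\frac1q-\frac12)-k-\frac s2}\big(\|f\|_{L^q}+e^{-\frac t4}\|f\|_{H^{k+s-1}(A)}\big),\qquad f\in L^q(X)\cap H^{k+s-1}(A).$$ (ii) For all $t\ge 1$, $$\|\partial_t^kA^{\frac s2}(\mathcal D(t,A)-e^{-tA})f\|_{L^\infty}\lesssim\langle t\rangle^{-\frac{2\alpha}{q}-k-\frac s2-1}\big(\|f\|_{L^q}+e^{-\frac t4}\|f\|_{H^\beta(A)}\big),\qquad f\in L^q(X)\cap H^\beta(A),$$ $$\|\partial_t^kA^{\frac s2}(\mathcal D(t,A)-e^{-tA})f\|_{L^2}\lesssim\langle t\rangle^{-2\alpha(\frac1q-\frac12)-k-\frac s2-1}\big(\|f\|_{L^q}+e^{-\frac t4}\|f\|_{H^{k+s-1}(A)}\big),\qquad f\in L^q(X)\cap H^{k+s-1}(A).$$ -/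

import Mathlib

open MeasureTheory Filter Topology
open scoped ENNReal InnerProductSpace

noncomputable section

section Spectral

variable {𝕜 H : Type*} [RCLike 𝕜] [NormedAddCommGroup H] [InnerProductSpace 𝕜 H] [CompleteSpace H]

variable (𝕜 H) in
/-- A resolution of the identity: a projection-valued measure on the Borel sets of `ℝ`, countably
additive in the strong operator topology. The projection `E_A(λ)` is `proj (Set.Iic λ)`. Values on
sets that are not Borel are irrelevant. -/
structure SpectralMeasure where
  proj : Set ℝ → H →L[𝕜] H
  isStarProjection : ∀ B, MeasurableSet B → IsStarProjection (proj B)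
  proj_univ : proj Set.univ = 1
  hasSum_iUnion : ∀ B : ℕ → Set ℝ, (∀ n, MeasurableSet (B n)) →
    Pairwise (Function.onFun Disjoint B) →
    ∀ f : H, HasSum (fun n => proj (B n) f) (proj (⋃ n, B n) f)

namespace SpectralMeasure

variable (E : SpectralMeasure 𝕜 H)

theorem proj_empty (f : H) : E.proj ∅ f = 0 := by
  have h := (E.hasSum_iUnion (fun _ => ∅) (fun _ => MeasurableSet.empty)
    (fun _ _ _ => disjoint_bot_left) f).summable
  exact (summable_const_iff _).1 h

theorem norm_sq_proj {B : Set ℝ} (hB : MeasurableSet B) (f : H) :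
    ‖E.proj B f‖ ^ 2 = RCLike.re (inner 𝕜 f (E.proj B f)) := by
  have hP := E.isStarProjection B hB
  have hs : ContinuousLinearMap.adjoint (E.proj B) = E.proj B := hP.isSelfAdjoint
  have hi : E.proj B (E.proj B f) = E.proj B f := by
    have := congrArg (fun T : H →L[𝕜] H => T f) hP.isIdempotentElem
    simpa using this
  rw [← inner_self_eq_norm_sq (𝕜 := 𝕜)]
  congr 1
  conv_lhs => rw [← ContinuousLinearMap.adjoint_inner_right, hs, hi]

/-- The finite Borel measure `d‖E(λ) f‖²`. -/
def scalarMeasure (f : H) : Measure ℝ :=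
  Measure.ofMeasurable (fun B _ => ENNReal.ofReal (‖E.proj B f‖ ^ 2))
    (by simp [E.proj_empty f])
    (by
      intro B hB hd
      have h := E.hasSum_iUnion B hB hd f
      have h2 : HasSum (fun n => ‖E.proj (B n) f‖ ^ 2) (‖E.proj (⋃ n, B n) f‖ ^ 2) := by
        simp_rw [E.norm_sq_proj (MeasurableSet.iUnion hB), fun n => E.norm_sq_proj (hB n) f]
        exact (h.mapL (innerSL 𝕜 f)).mapL RCLike.reCLM
      rw [← h2.tsum_eq, ENNReal.ofReal_tsum_of_nonneg (fun n => by positivity) h2.summable])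

theorem scalarMeasure_apply (f : H) {B : Set ℝ} (hB : MeasurableSet B) :
    E.scalarMeasure f B = ENNReal.ofReal (‖E.proj B f‖ ^ 2) :=
  Measure.ofMeasurable_apply B hB

theorem scalarMeasure_add_le (f g : H) :
    E.scalarMeasure (f + g) ≤ (2 : ℝ≥0∞) • (E.scalarMeasure f + E.scalarMeasure g) := by
  refine Measure.le_iff.2 fun B hB => ?_
  simp only [Measure.smul_apply, Measure.add_apply, smul_eq_mul, E.scalarMeasure_apply _ hB]
  rw [← ENNReal.ofReal_add (by positivity) (by positivity),
    show (2 : ℝ≥0∞) = ENNReal.ofReal 2 by simp, ← ENNReal.ofReal_mul (by norm_num)]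
  apply ENNReal.ofReal_le_ofReal
  rw [map_add]
  have := norm_add_le (E.proj B f) (E.proj B g)
  nlinarith [sq_nonneg (‖E.proj B f‖ - ‖E.proj B g‖), norm_nonneg (E.proj B f + E.proj B g)]

theorem scalarMeasure_smul (c : 𝕜) (f : H) :
    E.scalarMeasure (c • f) = ENNReal.ofReal (‖c‖ ^ 2) • E.scalarMeasure f := by
  refine Measure.ext fun B hB => ?_
  simp only [Measure.smul_apply, smul_eq_mul, E.scalarMeasure_apply _ hB]
  rw [map_smul, norm_smul, mul_pow, ENNReal.ofReal_mul (by positivity)]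

/-- `Dom(φ(A)) = {f : ∫ |φ(λ)|² d‖E(λ) f‖² < ∞}`. -/
def domain (φ : ℝ → ℝ) : Submodule 𝕜 H where
  carrier := {f | ∫⁻ x, ENNReal.ofReal (φ x ^ 2) ∂(E.scalarMeasure f) < ⊤}
  zero_mem' := by
    have : E.scalarMeasure (0 : H) = 0 := by
      refine Measure.ext fun B hB => ?_
      simp [E.scalarMeasure_apply _ hB]
    simp [this]
  add_mem' := by
    intro f g hf hg
    refine lt_of_le_of_lt (lintegral_mono' (E.scalarMeasure_add_le f g) le_rfl) ?_
    rw [lintegral_smul_measure, lintegral_add_measure]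
    exact ENNReal.mul_lt_top (by simp) (ENNReal.add_lt_top.2 ⟨hf, hg⟩)
  smul_mem' := by
    intro c f hf
    simp only [Set.mem_ofPred_eq, E.scalarMeasure_smul, lintegral_smul_measure]
    exact ENNReal.mul_lt_top ENNReal.ofReal_lt_top hf

/-- `∫ σ(λ) dE(λ) f` for a simple function `σ`. -/
def simpleIntegral (σ : SimpleFunc ℝ ℝ) (f : H) : H :=
  ∑ y ∈ σ.range, (y : 𝕜) • E.proj (σ ⁻¹' {y}) f

/-- `f ∈ Dom(φ(A))` and `φ(A) f = u`, where `φ(A) = ∫ φ(λ) dE(λ)` for a Borel function `φ`: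
`u` is the limit of `∫ σₙ(λ) dE(λ) f` for all simple functions `σₙ` that tend to `φ` in
`L²(d‖E(λ) f‖²)`. -/
def HasIntegral (φ : ℝ → ℝ) (f u : H) : Prop :=
  Measurable φ ∧ f ∈ E.domain φ ∧
    ∀ σ : ℕ → SimpleFunc ℝ ℝ,
      Tendsto (fun n => ∫⁻ x, ENNReal.ofReal ((σ n x - φ x) ^ 2) ∂(E.scalarMeasure f))
        atTop (𝓝 0) →
      Tendsto (fun n => E.simpleIntegral (σ n) f) atTop (𝓝 u)

/-- `E` is the spectral resolution of `A`: `A = ∫ λ dE(λ)`, with equality of domains. -/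
def IsResolutionOf (E : SpectralMeasure 𝕜 H) (A : H →ₗ.[𝕜] H) : Prop :=
  ∀ f u : H, (f, u) ∈ A.graph ↔ E.HasIntegral (fun x => x) f u

open Classical in
/-- The point mass at `0`, the spectral resolution of the zero operator. -/
instance : Nonempty (SpectralMeasure 𝕜 H) :=
  ⟨{ proj := fun B => if (0 : ℝ) ∈ B then 1 else 0
     isStarProjection := by
       intro B _
       split_ifs
       · exact IsStarProjection.one _
       · exact IsStarProjection.zero _
     proj_univ := by simp
     hasSum_iUnion := by
       intro B _ hd f
       by_cases h : ∃ n, (0 : ℝ) ∈ B n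
       · obtain ⟨n, hn⟩ := h
         have h0 : (0 : ℝ) ∈ ⋃ n, B n := Set.mem_iUnion.2 ⟨n, hn⟩
         rw [if_pos h0]
         convert hasSum_single n ?_ using 1
         · rw [if_pos hn]
         · intro m hm
           have : (0 : ℝ) ∉ B m := fun hm0 => Set.disjoint_left.1 (hd hm) hm0 hn
           rw [if_neg this]; rfl
       · have h0 : (0 : ℝ) ∉ ⋃ n, B n := by simpa using h
         rw [if_neg h0]
         have : ∀ n, (0 : ℝ) ∉ B n := by simpa using h
         simp only [this, if_false]
         exact hasSum_zero }⟩

end SpectralMeasure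

/-- The spectral resolution `E_A` of `A`: the (unique) projection-valued measure with
`A = ∫ λ dE_A(λ)` (arbitrary if there is none). -/
def spectralResolution (A : H →ₗ.[𝕜] H) : SpectralMeasure 𝕜 H :=
  Classical.epsilon fun E => E.IsResolutionOf A

/-- `f ∈ Dom(φ(A))` and `φ(A) f = u`. -/
def FuncCalc (A : H →ₗ.[𝕜] H) (φ : ℝ → ℝ) (f u : H) : Prop :=
  (spectralResolution A).HasIntegral φ f u

/-- The symbol of `(I + A)^{r/2}`. -/
def besselSymbol (r x : ℝ) : ℝ := (1 + x) ^ (r / 2)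

/-- The space `H^r(A) = Dom((I + A)^{r/2})`, for `r ≥ 0`. -/
def sobolevSpace (A : H →ₗ.[𝕜] H) (r : ℝ) : Submodule 𝕜 H :=
  (spectralResolution A).domain (besselSymbol r)

/-- `‖f‖_{H^r(A)} = ‖(I + A)^{r/2} f‖` for `r ≥ 0` (equal to `⊤` for `f` outside `H^r(A)`). -/
def sobolevNorm (A : H →ₗ.[𝕜] H) (r : ℝ) (f : H) : ℝ≥0∞ :=
  ⨅ (u : H) (_ : FuncCalc A (besselSymbol r) f u), ‖u‖ₑ

/-- The norm, in the dual `H^{-r}(A)` of `H^r(A)`, of a conjugate-linear functional on `H^r(A)`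
(equal to `⊤` if the functional is not bounded). -/
def dualNorm (A : H →ₗ.[𝕜] H) (r : ℝ) (F : sobolevSpace A r →ₗ⋆[𝕜] 𝕜) : ℝ≥0∞ :=
  ⨆ g : sobolevSpace A r, ‖F g‖ₑ / sobolevNorm A r (g : H)

end Spectral

section Functions

variable {X 𝕜 : Type*} [RCLike 𝕜] [MeasurableSpace X] {μ : Measure X}

/-- The function `f` on `X`, as a distribution, is the element `F` of `H^{-r}(A)`, `r > 0`:
`F` is bounded and acts on `H^r(A) ∩ L^∞(X)` by the integral pairing with `f`. -/
def IsDualElement (A : Lp 𝕜 2 μ →ₗ.[𝕜] Lp 𝕜 2 μ) (r : ℝ) (f : X → 𝕜)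
    (F : sobolevSpace A r →ₗ⋆[𝕜] 𝕜) : Prop :=
  dualNorm A r F < ⊤ ∧
    ∀ g : sobolevSpace A r, MemLp ((g : Lp 𝕜 2 μ) : X → 𝕜) ⊤ μ →
      F g = ∫ x, inner 𝕜 ((g : Lp 𝕜 2 μ) x) (f x) ∂μ

open Classical in
/-- `‖f‖_{H^γ(A)}` for a function `f` on `X` and an order `γ` of either sign; it is finite exactly
when `f` belongs to `H^γ(A)`. -/
def fnSobolevNorm (A : Lp 𝕜 2 μ →ₗ.[𝕜] Lp 𝕜 2 μ) (γ : ℝ) (f : X → 𝕜) : ℝ≥0∞ :=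
  if 0 ≤ γ then ⨅ h : MemLp f 2 μ, sobolevNorm A γ (h.toLp f)
  else ⨅ (F : sobolevSpace A (-γ) →ₗ⋆[𝕜] 𝕜) (_ : IsDualElement A (-γ) f F), dualNorm A (-γ) F

/-- `φ(A) f = u` in `L²(X)` for a function `f` in `H^γ(A)`. For `γ ≥ 0` this is the functional
calculus on `L²(X)`; for `γ < 0` it is its extension by duality to `H^γ(A)`, that is
`⟨φ(A) f, g⟩ = ⟨f, φ(A) g⟩` for `g ∈ L²(X)`, with the pairing of `H^γ(A)` and `H^{-γ}(A)` on the
right. -/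
def FnFuncCalc (A : Lp 𝕜 2 μ →ₗ.[𝕜] Lp 𝕜 2 μ) (γ : ℝ) (φ : ℝ → ℝ) (f : X → 𝕜)
    (u : Lp 𝕜 2 μ) : Prop :=
  (0 ≤ γ → ∃ h : MemLp f 2 μ, FuncCalc A φ (h.toLp f) u) ∧
  (γ < 0 → ∃ F : sobolevSpace A (-γ) →ₗ⋆[𝕜] 𝕜, IsDualElement A (-γ) f F ∧
    ∀ g : Lp 𝕜 2 μ, ∃ v : sobolevSpace A (-γ), FuncCalc A φ g (v : Lp 𝕜 2 μ) ∧
      inner 𝕜 g u = F v)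

/-- `‖e^{-tA}‖_{L² → L^∞} ≲ t^{-α}` for `t > 0`. -/
def HeatDecay (A : Lp 𝕜 2 μ →ₗ.[𝕜] Lp 𝕜 2 μ) (α : ℝ) : Prop :=
  ∃ C : ℝ, 0 < C ∧ ∀ t : ℝ, 0 < t → ∀ f u : Lp 𝕜 2 μ,
    FuncCalc A (fun x => Real.exp (-(t * x))) f u →
    eLpNorm u ⊤ μ ≤ ENNReal.ofReal (C * t ^ (-α)) * eLpNorm f 2 μ

end Functions

/-- The symbol `𝒟(t, λ)`. -/
def dampedSymbol (t x : ℝ) : ℝ :=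
  if x < 1 / 4 then
    Real.exp (-t / 2) * Real.sinh (t * Real.sqrt (1 / 4 - x)) / Real.sqrt (1 / 4 - x)
  else if x = 1 / 4 then t * Real.exp (-t / 2)
  else Real.exp (-t / 2) * Real.sin (t * Real.sqrt (x - 1 / 4)) / Real.sqrt (x - 1 / 4)

/-- The symbol of `A^{s/2} 𝒟(t, A)`. -/
def solutionSymbol (s t x : ℝ) : ℝ := x ^ (s / 2) * dampedSymbol t x

/-- The symbol of `A^{s/2} (𝒟(t, A) - e^{-tA})`. -/
def differenceSymbol (s t x : ℝ) : ℝ :=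
  x ^ (s / 2) * (dampedSymbol t x - Real.exp (-(t * x)))

/-- `⟨t⟩ = (1 + t²)^{1/2}`. -/
def japaneseBracket (t : ℝ) : ℝ := Real.sqrt (1 + t ^ 2)

section Estimate

variable {X 𝕜 : Type*} [RCLike 𝕜] [MeasurableSpace X] {μ : Measure X}

/-- For the family of operators `m(t, A)`, the estimate
`‖∂_t^k m(t, A) f‖_{L^p} ≤ C ⟨t⟩^{-ρ} (‖f‖_{L^q} + e^{-t/4} ‖f‖_{H^γ(A)})` holds with a constant `C`
independent of `f ∈ L^q(X) ∩ H^γ(A)` and `t ∈ T`. It includes that `m(t, A) f` is defined, as an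
element of `L²(X)`, for all `t > 0`, and that its time derivatives up to order `k` exist in
`L²(X)` at all `t ∈ T`. -/
def DecayEstimate (A : Lp 𝕜 2 μ →ₗ.[𝕜] Lp 𝕜 2 μ) (m : ℝ → ℝ → ℝ) (k : ℕ) (p q : ℝ≥0∞)
    (γ ρ : ℝ) (T : Set ℝ) : Prop :=
  ∃ C : ℝ, 0 < C ∧ ∀ f : X → 𝕜, MemLp f q μ → fnSobolevNorm A γ f < ⊤ →
    ∃ w : ℝ → Lp 𝕜 2 μ, (∀ t, 0 < t → FnFuncCalc A γ (m t) f (w t)) ∧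
      ∀ t ∈ T, (∀ j < k, DifferentiableAt ℝ (iteratedDeriv j w) t) ∧
        eLpNorm (iteratedDeriv k w t : Lp 𝕜 2 μ) p μ ≤
          ENNReal.ofReal (C * japaneseBracket t ^ (-ρ)) *
            (eLpNorm f q μ + ENNReal.ofReal (Real.exp (-t / 4)) * fnSobolevNorm A γ f)

end Estimate

end

noncomputable section

/-! ### Projections and integrals of simple functions -/

section SpectralCalculus

variable {𝕜 H : Type*} [RCLike 𝕜] [NormedAddCommGroup H] [InnerProductSpace 𝕜 H] [CompleteSpace H]

namespace SpectralMeasure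

variable (E : SpectralMeasure 𝕜 H)

/-! The spectral calculus turns the theorem into bounds on scalar symbols: `HasIntegral.enorm_sq`
computes `‖φ(A) f‖²` as `∫ |φ|² d‖E(λ) f‖²`, so a pointwise inequality between symbols is an
inequality between `L²` norms. Heat decay leaves no spectral mass on `(-∞, 0]`, so only `λ > 0`
matters.

A function in `H^γ(A)`, with `γ` of either sign, is `f = (I + A)^{-γ/2} h` with `h` in `L²` and `‖h‖
≤ ‖f‖_{H^γ}` (`exists_represents`). Every operator in the theorem then becomes a bounded function of
`A` applied to `h`.

The spectrum is cut at `21/100`, strictly below the critical value `1/4`. Below the cut, `λ = p (1 -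
p)` with `0 < p ≤ 3/10`, and `𝒟(t, λ) = (e^{-tp} - e^{-t(1-p)}) / (1 - 2p)`. Since `p ≥ λ`, the
first exponential is at most `e^{-tλ}`, the second is at most `e^{-t/2}`, and in the presence of
`e^{-tλ}` each power `λ^a` is worth `(1 + t)^{-a}`. Moreover `p - λ = p²` and `1/(1 - 2p) - 1 =
O(p)`, so subtracting `e^{-tλ}` gains one more factor `λ`, hence the extra decay in (ii). What
remains is a heat operator at time comparable to `1 + t`: duality and interpolation give its `L^q →
L²` bound (`Represents.enorm_heat_le`), and a further `L² → L^∞` step gives `L^q → L^∞`.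

Above the cut, the symbol of `∂_t^k A^{s/2} 𝒟(t, A)` is `O(e^{-7t/25} (1 + λ)^{(k+s-1)/2})`, and
`7/25 > 1/4`. It is paid for by the Sobolev norm: directly in `L²`, and in `L^∞` through the
embedding of `H^σ(A)` for `σ > 2α` (`HeatBound.exists_eLpNorm_top_le`) with `σ = β - (k + s - 1)`.
-/

theorem proj_union {B B' : Set ℝ} (hB : MeasurableSet B) (hB' : MeasurableSet B')
    (hd : Disjoint B B') : E.proj (B ∪ B') = E.proj B + E.proj B' := by
  ext f
  let S : ℕ → Set ℝ := fun n => if n = 0 then B else if n = 1 then B' else ∅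
  have hS : ∀ n, MeasurableSet (S n) := by
    intro n
    simp only [S]
    split_ifs <;> simp [hB, hB']
  have hU : ⋃ n, S n = B ∪ B' := by
    ext x
    simp only [S, Set.mem_iUnion, Set.mem_union]
    constructor
    · rintro ⟨n, hn⟩
      split_ifs at hn
      · exact Or.inl hn
      · exact Or.inr hn
      · simp at hn
    · rintro (h | h)
      · exact ⟨0, by simpa using h⟩
      · exact ⟨1, by simpa using h⟩
  have hdis : Pairwise (Function.onFun Disjoint S) := by
    intro m n hmn
    simp only [Function.onFun, S]
    split_ifs <;> first | omega | simp [hd.symm]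
  have h1 := E.hasSum_iUnion S hS hdis f
  have h2 : HasSum (fun n => E.proj (S n) f) (∑ n ∈ {0, 1}, E.proj (S n) f) := by
    refine hasSum_sum_of_ne_finset_zero fun n hn => ?_
    have : n ≠ 0 ∧ n ≠ 1 := by simpa using hn
    simp [S, this.1, this.2, E.proj_empty]
  rw [hU] at h1
  simpa [S] using h1.unique h2

theorem proj_comp_self {B : Set ℝ} (hB : MeasurableSet B) (f : H) :
    E.proj B (E.proj B f) = E.proj B f :=
  congrArg (fun T : H →L[𝕜] H => T f) (E.isStarProjection B hB).isIdempotentElem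

theorem inner_proj_left {B : Set ℝ} (hB : MeasurableSet B) (f g : H) :
    inner 𝕜 (E.proj B f) g = inner 𝕜 f (E.proj B g) := by
  have hs : ContinuousLinearMap.adjoint (E.proj B) = E.proj B :=
    (E.isStarProjection B hB).isSelfAdjoint
  conv_rhs => rw [← hs]
  rw [ContinuousLinearMap.adjoint_inner_right]

/-- Write `P`, `P'` for the two projections. Since `P + P'` is again idempotent, `PP' + P'P = 0`;
composing with `P` on both sides gives `2 PP'P = 0`, and composing on the left only then gives `PP'
= 0`. -/
theorem proj_comp_of_disjoint {B B' : Set ℝ} (hB : MeasurableSet B) (hB' : MeasurableSet B')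
    (hd : Disjoint B B') (f : H) : E.proj B (E.proj B' f) = 0 := by
  have h : ∀ g : H, E.proj B (E.proj B' g) + E.proj B' (E.proj B g) = 0 := by
    intro g
    have h := E.proj_comp_self (hB.union hB') g
    simp only [E.proj_union hB hB' hd, add_apply, map_add,
      E.proj_comp_self hB, E.proj_comp_self hB'] at h
    have : E.proj B g + E.proj B' g + (E.proj B (E.proj B' g) + E.proj B' (E.proj B g)) =
        E.proj B g + E.proj B' g + 0 := by
      rw [add_zero]
      refine Eq.trans ?_ h
      abel
    exact add_left_cancel this
  have h1 := congrArg (E.proj B) (h (E.proj B f))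
  have h2 := congrArg (E.proj B) (h f)
  simp only [map_add, map_zero, E.proj_comp_self hB] at h1 h2
  have h3 : (2 : 𝕜) • E.proj B (E.proj B' (E.proj B f)) = 0 := by rw [two_smul]; exact h1
  have h4 : E.proj B (E.proj B' (E.proj B f)) = 0 :=
    (smul_eq_zero.1 h3).resolve_left two_ne_zero
  rw [h4, add_zero] at h2
  exact h2

theorem proj_inter {B B' : Set ℝ} (hB : MeasurableSet B) (hB' : MeasurableSet B') (f : H) :
    E.proj B (E.proj B' f) = E.proj (B ∩ B') f := by
  have h1 : E.proj B' = E.proj (B ∩ B') + E.proj (B' \ B) := by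
    rw [← E.proj_union (hB.inter hB') (hB'.diff hB)
      (Set.disjoint_left.2 fun x hx hx' => hx'.2 hx.1)]
    congr 1; ext x; simp only [Set.mem_union, Set.mem_inter_iff, Set.mem_sdiff]; tauto
  have h2 : E.proj B = E.proj (B ∩ B') + E.proj (B \ B') := by
    rw [← E.proj_union (hB.inter hB') (hB.diff hB')
      (Set.disjoint_left.2 fun x hx hx' => hx'.2 hx.2)]
    congr 1; ext x; simp only [Set.mem_union, Set.mem_inter_iff, Set.mem_sdiff]; tauto
  rw [h1, add_apply, map_add,
    E.proj_comp_of_disjoint hB (hB'.diff hB) Set.disjoint_sdiff_right, h2,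
    add_apply, E.proj_comp_self (hB.inter hB'),
    E.proj_comp_of_disjoint (hB.diff hB') (hB.inter hB')
      (Set.disjoint_left.2 fun x hx hx' => hx.2 hx'.2)]
  simp

theorem proj_preimage_finset {β : Type*} (ρ : SimpleFunc ℝ β) (s : Finset β) (f : H) :
    E.proj (ρ ⁻¹' (s : Set β)) f = ∑ b ∈ s, E.proj (ρ ⁻¹' {b}) f := by
  classical
  induction s using Finset.induction_on with
  | empty => simp [E.proj_empty]
  | insert b s hb ih =>
    rw [Finset.sum_insert hb, Finset.coe_insert, Set.insert_eq, Set.preimage_union,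
      E.proj_union (ρ.measurableSet_preimage _) (ρ.measurableSet_preimage _), add_apply, ih]
    exact Disjoint.preimage _ (by simpa using hb)

/-- A simple integral may be computed on any finer partition than its level sets. Applied to the
pairing of two simple functions, this yields the additivity and multiplicativity of the calculus. -/
theorem simpleIntegral_map {β : Type*} (ρ : SimpleFunc ℝ β) (g : β → ℝ) (f : H) :
    E.simpleIntegral (ρ.map g) f = ∑ b ∈ ρ.range, (g b : 𝕜) • E.proj (ρ ⁻¹' {b}) f := by
  classical
  rw [simpleIntegral, ← Finset.sum_fiberwise_of_maps_to (s := ρ.range) (t := (ρ.map g).range)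
    (g := g) (fun b hb => by
      obtain ⟨x, rfl⟩ := SimpleFunc.mem_range.1 hb
      exact SimpleFunc.mem_range.2 ⟨x, rfl⟩)]
  refine Finset.sum_congr rfl fun y _ => ?_
  rw [SimpleFunc.map_preimage_singleton, E.proj_preimage_finset, Finset.smul_sum]
  refine Finset.sum_congr (by congr) fun b hb => ?_
  rw [(Finset.mem_filter.1 hb).2]

theorem simpleIntegral_sub (σ τ : SimpleFunc ℝ ℝ) (f : H) :
    E.simpleIntegral (σ - τ) f = E.simpleIntegral σ f - E.simpleIntegral τ f := by
  have h1 := E.simpleIntegral_map (σ.pair τ) (fun p => p.1 - p.2) f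
  have h2 := E.simpleIntegral_map (σ.pair τ) (fun p => p.1) f
  have h3 := E.simpleIntegral_map (σ.pair τ) (fun p => p.2) f
  rw [show (σ.pair τ).map (fun p => p.1 - p.2) = σ - τ from rfl] at h1
  rw [show (σ.pair τ).map (fun p => p.1) = σ from rfl] at h2
  rw [show (σ.pair τ).map (fun p => p.2) = τ from rfl] at h3
  rw [h1, h2, h3, ← Finset.sum_sub_distrib]
  simp [sub_smul]

theorem simpleIntegral_add (σ τ : SimpleFunc ℝ ℝ) (f : H) :
    E.simpleIntegral (σ + τ) f = E.simpleIntegral σ f + E.simpleIntegral τ f := by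
  have h1 := E.simpleIntegral_map (σ.pair τ) (fun p => p.1 + p.2) f
  have h2 := E.simpleIntegral_map (σ.pair τ) (fun p => p.1) f
  have h3 := E.simpleIntegral_map (σ.pair τ) (fun p => p.2) f
  rw [show (σ.pair τ).map (fun p => p.1 + p.2) = σ + τ from rfl] at h1
  rw [show (σ.pair τ).map (fun p => p.1) = σ from rfl] at h2
  rw [show (σ.pair τ).map (fun p => p.2) = τ from rfl] at h3
  rw [h1, h2, h3, ← Finset.sum_add_distrib]
  simp [add_smul]

theorem simpleIntegral_const_mul (c : ℝ) (σ : SimpleFunc ℝ ℝ) (f : H) :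
    E.simpleIntegral (σ.map (c * ·)) f = (c : 𝕜) • E.simpleIntegral σ f := by
  rw [E.simpleIntegral_map, simpleIntegral, Finset.smul_sum]
  simp [mul_smul]

theorem simpleIntegral_comp (σ τ : SimpleFunc ℝ ℝ) (f : H) :
    E.simpleIntegral σ (E.simpleIntegral τ f) = E.simpleIntegral (σ * τ) f := by
  classical
  have h1 := E.simpleIntegral_map (σ.pair τ) (fun p => p.1 * p.2) f
  rw [show (σ.pair τ).map (fun p => p.1 * p.2) = σ * τ from rfl] at h1
  rw [h1]
  -- The double sum runs over all pairs of values; pairs that are never attained have empty preimage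
  -- and contribute zero.
  have hsub : (σ.pair τ).range ⊆ σ.range ×ˢ τ.range := by
    intro p hp
    obtain ⟨x, rfl⟩ := SimpleFunc.mem_range.1 hp
    simp
  rw [Finset.sum_subset hsub, Finset.sum_product]
  · simp only [simpleIntegral, map_sum, map_smul, Finset.smul_sum]
    refine Finset.sum_congr rfl fun y _ => Finset.sum_congr rfl fun z _ => ?_
    rw [E.proj_inter (σ.measurableSet_preimage _) (τ.measurableSet_preimage _), smul_smul]
    push_cast
    congr 3
    ext x; simp [Prod.ext_iff]
  · intro p _ hp
    have : (σ.pair τ) ⁻¹' {p} = ∅ := by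
      ext x
      simp only [Set.mem_preimage, Set.mem_singleton_iff, Set.mem_empty_iff_false, iff_false]
      rintro rfl
      exact hp (SimpleFunc.mem_range_self _ x)
    rw [this, E.proj_empty, smul_zero]

theorem simpleIntegral_vec_add (σ : SimpleFunc ℝ ℝ) (f g : H) :
    E.simpleIntegral σ (f + g) = E.simpleIntegral σ f + E.simpleIntegral σ g := by
  simp [simpleIntegral, Finset.sum_add_distrib]

theorem simpleIntegral_vec_smul (σ : SimpleFunc ℝ ℝ) (c : 𝕜) (f : H) :
    E.simpleIntegral σ (c • f) = c • E.simpleIntegral σ f := by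
  simp only [simpleIntegral, map_smul, Finset.smul_sum]
  exact Finset.sum_congr rfl fun y _ => smul_comm _ _ _

theorem continuous_simpleIntegral (σ : SimpleFunc ℝ ℝ) : Continuous (E.simpleIntegral σ) := by
  unfold simpleIntegral
  fun_prop

theorem inner_simpleIntegral_left (σ : SimpleFunc ℝ ℝ) (f g : H) :
    inner 𝕜 (E.simpleIntegral σ f) g = inner 𝕜 f (E.simpleIntegral σ g) := by
  simp only [simpleIntegral, sum_inner, inner_sum, inner_smul_left, inner_smul_right,
    RCLike.conj_ofReal]
  refine Finset.sum_congr rfl fun y _ => ?_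
  rw [E.inner_proj_left (σ.measurableSet_preimage _)]

/-- Self-adjointness and multiplicativity give `‖σ(A) f‖² = ⟨f, σ²(A) f⟩`. This isometry is what
extends the calculus from simple functions to `L²(d‖E f‖²)`. -/
theorem enorm_sq_simpleIntegral (σ : SimpleFunc ℝ ℝ) (f : H) :
    ‖E.simpleIntegral σ f‖ₑ ^ 2 = ∫⁻ x, ENNReal.ofReal (σ x ^ 2) ∂(E.scalarMeasure f) := by
  have h1 : ∫⁻ x, ENNReal.ofReal (σ x ^ 2) ∂(E.scalarMeasure f) =
      ∑ y ∈ σ.range, ENNReal.ofReal (y ^ 2) * E.scalarMeasure f (σ ⁻¹' {y}) := by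
    rw [← SimpleFunc.map_lintegral (fun y => ENNReal.ofReal (y ^ 2)),
      ← SimpleFunc.lintegral_eq_lintegral]
    rfl
  have h2 : ‖E.simpleIntegral σ f‖ ^ 2 = ∑ y ∈ σ.range, y ^ 2 * ‖E.proj (σ ⁻¹' {y}) f‖ ^ 2 := by
    rw [← inner_self_eq_norm_sq (𝕜 := 𝕜), E.inner_simpleIntegral_left, E.simpleIntegral_comp,
      show σ * σ = σ.map (fun y => y * y) from rfl, E.simpleIntegral_map, inner_sum, map_sum]
    refine Finset.sum_congr rfl fun y _ => ?_
    rw [inner_smul_right, E.norm_sq_proj (σ.measurableSet_preimage _), RCLike.re_ofReal_mul]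
    ring
  rw [h1, ← ofReal_norm, ← ENNReal.ofReal_pow (norm_nonneg _), h2,
    ENNReal.ofReal_sum_of_nonneg (fun y _ => by positivity)]
  refine Finset.sum_congr rfl fun y _ => ?_
  rw [E.scalarMeasure_apply _ (σ.measurableSet_preimage _), ENNReal.ofReal_mul (by positivity)]

theorem scalarMeasure_univ (f : H) : E.scalarMeasure f Set.univ = ‖f‖ₑ ^ 2 := by
  rw [E.scalarMeasure_apply _ MeasurableSet.univ, E.proj_univ, ENNReal.ofReal_pow (norm_nonneg _),
    ofReal_norm]
  rfl

instance (f : H) : IsFiniteMeasure (E.scalarMeasure f) :=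
  ⟨by rw [E.scalarMeasure_univ]; exact ENNReal.pow_lt_top enorm_lt_top⟩

end SpectralMeasure

end SpectralCalculus

/-! ### Functional calculus for Borel symbols -/

theorem ENNReal.ofReal_sub_sq_le (a b c : ℝ) :
    ENNReal.ofReal ((a - b) ^ 2) ≤
      2 * (ENNReal.ofReal ((a - c) ^ 2) + ENNReal.ofReal ((b - c) ^ 2)) := by
  rw [← ENNReal.ofReal_add (by positivity) (by positivity),
    show (2 : ℝ≥0∞) = ENNReal.ofReal 2 by simp, ← ENNReal.ofReal_mul (by norm_num)]
  exact ENNReal.ofReal_le_ofReal (by nlinarith [sq_nonneg (a - c + (b - c))])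

theorem lintegral_ofReal_sq_eq_eLpNorm (ν : Measure ℝ) (φ : ℝ → ℝ) :
    ∫⁻ x, ENNReal.ofReal (φ x ^ 2) ∂ν = eLpNorm φ 2 ν ^ 2 := by
  rw [eLpNorm_eq_lintegral_rpow_enorm_toReal (by simp) (by simp)]
  simp only [ENNReal.toReal_ofNat, ENNReal.rpow_ofNat]
  rw [← ENNReal.rpow_natCast, ← ENNReal.rpow_mul]
  norm_num
  refine lintegral_congr fun x => ?_
  rw [Real.enorm_eq_ofReal_abs, ← ENNReal.ofReal_pow (abs_nonneg _), sq_abs]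

theorem exists_simpleFunc_tendsto_sq (ν : Measure ℝ) {φ : ℝ → ℝ} (hm : Measurable φ)
    (hφ : ∫⁻ x, ENNReal.ofReal (φ x ^ 2) ∂ν < ⊤) :
    ∃ σ : ℕ → SimpleFunc ℝ ℝ,
      Tendsto (fun n => ∫⁻ x, ENNReal.ofReal ((σ n x - φ x) ^ 2) ∂ν) atTop (𝓝 0) := by
  rw [lintegral_ofReal_sq_eq_eLpNorm] at hφ
  have h2 : eLpNorm φ 2 ν < ⊤ := by
    by_contra h
    rw [not_lt_top_iff.1 h] at hφ
    simp at hφ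
  have h := SimpleFunc.tendsto_approxOn_range_Lp_eLpNorm (p := 2) (by simp) (μ := ν) hm h2
  have h' := ENNReal.Tendsto.pow (n := 2) h
  rw [zero_pow two_ne_zero] at h'
  refine ⟨fun n => SimpleFunc.approxOn φ hm (Set.range φ ∪ {0}) 0 (by simp) n,
    h'.congr fun n => ?_⟩
  rw [← lintegral_ofReal_sq_eq_eLpNorm]
  rfl

section SpectralCalculus

variable {𝕜 H : Type*} [RCLike 𝕜] [NormedAddCommGroup H] [InnerProductSpace 𝕜 H] [CompleteSpace H]

namespace SpectralMeasure

variable (E : SpectralMeasure 𝕜 H)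

theorem enorm_sq_simpleIntegral_sub (σ τ : SimpleFunc ℝ ℝ) (f : H) :
    ‖E.simpleIntegral σ f - E.simpleIntegral τ f‖ₑ ^ 2 =
      ∫⁻ x, ENNReal.ofReal ((σ x - τ x) ^ 2) ∂(E.scalarMeasure f) := by
  rw [← E.simpleIntegral_sub, E.enorm_sq_simpleIntegral]
  rfl

theorem enorm_sq_simpleIntegral_sub_le (σ τ : SimpleFunc ℝ ℝ) {φ : ℝ → ℝ} (hφ : Measurable φ)
    (f : H) :
    ‖E.simpleIntegral σ f - E.simpleIntegral τ f‖ₑ ^ 2 ≤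
      2 * (∫⁻ x, ENNReal.ofReal ((σ x - φ x) ^ 2) ∂(E.scalarMeasure f) +
        ∫⁻ x, ENNReal.ofReal ((τ x - φ x) ^ 2) ∂(E.scalarMeasure f)) := by
  have hσ := σ.measurable
  have hτ := τ.measurable
  rw [E.enorm_sq_simpleIntegral_sub, ← lintegral_add_left (by fun_prop),
    ← lintegral_const_mul _ (by fun_prop)]
  exact lintegral_mono fun x => ENNReal.ofReal_sub_sq_le _ _ _

theorem tendsto_of_tendsto_enorm_sq {ι F : Type*} [NormedAddCommGroup F] {l : Filter ι}
    {u : ι → F} {v : F} (h : Tendsto (fun i => ‖u i - v‖ₑ ^ 2) l (𝓝 0)) : Tendsto u l (𝓝 v) := by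
  rw [tendsto_iff_edist_tendsto_0]
  have h' := h.ennrpow_const (1 / 2)
  rw [ENNReal.zero_rpow_of_pos (by norm_num)] at h'
  refine h'.congr fun i => ?_
  rw [edist_eq_enorm_sub, ← ENNReal.rpow_natCast, ← ENNReal.rpow_mul]
  norm_num

variable {E}

/-- By the isometry, two sequences approximating `φ` in `L²(d‖E f‖²)` have images whose difference
tends to zero, so the condition on all sequences in `HasIntegral` need only be checked on one. -/
theorem hasIntegral_of_tendsto {φ : ℝ → ℝ} {f u : H} (hm : Measurable φ) (hf : f ∈ E.domain φ)
    {σ : ℕ → SimpleFunc ℝ ℝ}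
    (hσ : Tendsto (fun n => ∫⁻ x, ENNReal.ofReal ((σ n x - φ x) ^ 2) ∂(E.scalarMeasure f))
      atTop (𝓝 0))
    (hu : Tendsto (fun n => E.simpleIntegral (σ n) f) atTop (𝓝 u)) : E.HasIntegral φ f u := by
  refine ⟨hm, hf, fun τ hτ => ?_⟩
  have h : Tendsto (fun n => E.simpleIntegral (τ n) f - E.simpleIntegral (σ n) f) atTop (𝓝 0) := by
    apply tendsto_of_tendsto_enorm_sq
    have h2 := ENNReal.Tendsto.const_mul (a := 2) (hτ.add hσ) (Or.inr (by simp))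
    rw [add_zero, mul_zero] at h2
    refine tendsto_of_tendsto_of_tendsto_of_le_of_le tendsto_const_nhds h2 (fun _ => zero_le)
      fun n => ?_
    simpa using E.enorm_sq_simpleIntegral_sub_le (τ n) (σ n) hm f
  simpa using h.add hu

theorem exists_hasIntegral {φ : ℝ → ℝ} {f : H} (hm : Measurable φ) (hf : f ∈ E.domain φ) :
    ∃ u, E.HasIntegral φ f u := by
  obtain ⟨σ, hσ⟩ := exists_simpleFunc_tendsto_sq (E.scalarMeasure f) hm hf
  have hc : CauchySeq fun n => E.simpleIntegral (σ n) f := by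
    rw [EMetric.cauchySeq_iff]
    intro ε hε
    -- Chosen so that `2 (ε²/4 + ε²/4) = ε²` in `enorm_sq_simpleIntegral_sub_le`.
    have hε4 : 0 < ε ^ 2 / 4 := ENNReal.div_pos (by positivity) (by simp)
    obtain ⟨N, hN⟩ := eventually_atTop.1 (hσ.eventually (gt_mem_nhds hε4))
    refine ⟨N, fun m hm' n hn => ?_⟩
    rw [edist_eq_enorm_sub]
    refine (ENNReal.pow_right_strictMono (n := 2) (by simp)).lt_iff_lt.1 ?_
    refine (E.enorm_sq_simpleIntegral_sub_le (σ m) (σ n) hm f).trans_lt ?_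
    have h4 : 2 * (ε ^ 2 / 4 + ε ^ 2 / 4) = ε ^ 2 := by
      rw [← two_mul, ← mul_assoc, show (2 : ℝ≥0∞) * 2 = 4 by norm_num]
      exact ENNReal.mul_div_cancel (by simp) (by simp)
    rw [← h4]
    exact (ENNReal.mul_lt_mul_iff_right (by simp) (by simp)).2
      (ENNReal.add_lt_add (hN m hm') (hN n hn))
  obtain ⟨u, hu⟩ := cauchySeq_tendsto_of_complete hc
  exact ⟨u, hasIntegral_of_tendsto hm hf hσ hu⟩

theorem HasIntegral.unique {φ : ℝ → ℝ} {f u v : H} (hu : E.HasIntegral φ f u)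
    (hv : E.HasIntegral φ f v) : u = v := by
  obtain ⟨σ, hσ⟩ := exists_simpleFunc_tendsto_sq (E.scalarMeasure f) hu.1 hu.2.1
  exact tendsto_nhds_unique (hu.2.2 σ hσ) (hv.2.2 σ hσ)

theorem HasIntegral.congr {φ ψ : ℝ → ℝ} {f u : H} (hu : E.HasIntegral φ f u)
    (hm : Measurable ψ) (h : φ =ᵐ[E.scalarMeasure f] ψ) : E.HasIntegral ψ f u := by
  obtain ⟨σ, hσ⟩ := exists_simpleFunc_tendsto_sq (E.scalarMeasure f) hu.1 hu.2.1
  refine hasIntegral_of_tendsto hm ?_ ?_ (hu.2.2 σ hσ)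
  · refine lt_of_eq_of_lt (lintegral_congr_ae ?_) hu.2.1
    filter_upwards [h] with x hx
    rw [hx]
  · refine hσ.congr fun n => lintegral_congr_ae ?_
    filter_upwards [h] with x hx
    rw [hx]

theorem hasIntegral_simpleFunc (σ : SimpleFunc ℝ ℝ) (f : H) :
    E.HasIntegral σ f (E.simpleIntegral σ f) := by
  refine hasIntegral_of_tendsto σ.measurable ?_ (σ := fun _ => σ) (by simp) tendsto_const_nhds
  change ∫⁻ x, ENNReal.ofReal (σ x ^ 2) ∂(E.scalarMeasure f) < ⊤
  rw [← E.enorm_sq_simpleIntegral]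
  exact ENNReal.pow_lt_top enorm_lt_top

theorem mem_domain_add {φ ψ : ℝ → ℝ} {f : H} (hm : Measurable φ) (hf : f ∈ E.domain φ)
    (hg : f ∈ E.domain ψ) : f ∈ E.domain (fun x => φ x + ψ x) := by
  change ∫⁻ x, ENNReal.ofReal ((φ x + ψ x) ^ 2) ∂(E.scalarMeasure f) < ⊤
  have : ∀ x, ENNReal.ofReal ((φ x + ψ x) ^ 2) ≤
      2 * (ENNReal.ofReal (φ x ^ 2) + ENNReal.ofReal (ψ x ^ 2)) := fun x => by
    simpa using ENNReal.ofReal_sub_sq_le (φ x) (-ψ x) 0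
  refine (lintegral_mono this).trans_lt ?_
  rw [lintegral_const_mul' _ _ (by simp), lintegral_add_left (by fun_prop)]
  exact ENNReal.mul_lt_top (by simp) (ENNReal.add_lt_top.2 ⟨hf, hg⟩)

theorem HasIntegral.add {φ ψ : ℝ → ℝ} {f u v : H} (hu : E.HasIntegral φ f u)
    (hv : E.HasIntegral ψ f v) : E.HasIntegral (fun x => φ x + ψ x) f (u + v) := by
  obtain ⟨σ, hσ⟩ := exists_simpleFunc_tendsto_sq (E.scalarMeasure f) hu.1 hu.2.1
  obtain ⟨τ, hτ⟩ := exists_simpleFunc_tendsto_sq (E.scalarMeasure f) hv.1 hv.2.1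
  have hφ := hu.1
  refine hasIntegral_of_tendsto (hu.1.add hv.1) (mem_domain_add hu.1 hu.2.1 hv.2.1)
    (σ := fun n => σ n + τ n) ?_ ?_
  · have h2 := ENNReal.Tendsto.const_mul (a := 2) (hσ.add hτ) (Or.inr (by simp))
    rw [add_zero, mul_zero] at h2
    refine tendsto_of_tendsto_of_tendsto_of_le_of_le tendsto_const_nhds h2 (fun _ => zero_le)
      fun n => ?_
    have hσ' := (σ n).measurable
    simp only
    rw [← lintegral_add_left (by fun_prop), ← lintegral_const_mul' _ _ (by simp)]
    refine lintegral_mono fun x => ?_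
    have := ENNReal.ofReal_sub_sq_le (σ n x - φ x) (-(τ n x - ψ x)) 0
    simp only [sub_zero, neg_sq, sub_neg_eq_add] at this
    convert this using 3
    simp only [SimpleFunc.coe_add, Pi.add_apply]
    ring
  · simp only [E.simpleIntegral_add]
    exact (hu.2.2 σ hσ).add (hv.2.2 τ hτ)

theorem HasIntegral.const_mul {φ : ℝ → ℝ} {f u : H} (hu : E.HasIntegral φ f u) (c : ℝ) :
    E.HasIntegral (fun x => c * φ x) f ((c : 𝕜) • u) := by
  obtain ⟨σ, hσ⟩ := exists_simpleFunc_tendsto_sq (E.scalarMeasure f) hu.1 hu.2.1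
  have hsq : ∀ a : ℝ, ENNReal.ofReal ((c * a) ^ 2) = ENNReal.ofReal (c ^ 2) *
      ENNReal.ofReal (a ^ 2) := fun a => by
    rw [mul_pow, ENNReal.ofReal_mul (by positivity)]
  refine hasIntegral_of_tendsto (hu.1.const_mul c) ?_ (σ := fun n => (σ n).map (c * ·)) ?_ ?_
  · change ∫⁻ x, ENNReal.ofReal ((c * φ x) ^ 2) ∂(E.scalarMeasure f) < ⊤
    simp only [hsq]
    rw [lintegral_const_mul' _ _ (by simp)]
    exact ENNReal.mul_lt_top (by simp) hu.2.1
  · have h2 := ENNReal.Tendsto.const_mul (a := ENNReal.ofReal (c ^ 2)) hσ (Or.inr (by simp))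
    rw [mul_zero] at h2
    refine h2.congr fun n => ?_
    rw [← lintegral_const_mul' _ _ (by simp)]
    refine lintegral_congr fun x => ?_
    rw [← hsq, mul_sub]
    rfl
  · simp only [E.simpleIntegral_const_mul]
    exact (hu.2.2 σ hσ).const_smul _

theorem HasIntegral.enorm_sq {φ : ℝ → ℝ} {f u : H} (hu : E.HasIntegral φ f u) :
    ‖u‖ₑ ^ 2 = ∫⁻ x, ENNReal.ofReal (φ x ^ 2) ∂(E.scalarMeasure f) := by
  rw [lintegral_ofReal_sq_eq_eLpNorm]
  obtain ⟨σ, hσ⟩ := exists_simpleFunc_tendsto_sq (E.scalarMeasure f) hu.1 hu.2.1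
  have h1 : Tendsto (fun n => ‖E.simpleIntegral (σ n) f‖ₑ) atTop (𝓝 ‖u‖ₑ) :=
    (hu.2.2 σ hσ).enorm
  have h2 : ∀ n, ‖E.simpleIntegral (σ n) f‖ₑ = eLpNorm (σ n) 2 (E.scalarMeasure f) := by
    intro n
    have := E.enorm_sq_simpleIntegral (σ n) f
    rw [lintegral_ofReal_sq_eq_eLpNorm] at this
    exact (ENNReal.pow_right_strictMono (n := 2) (by simp)).injective this
  have h3 : Tendsto (fun n => eLpNorm (fun x => σ n x - φ x) 2 (E.scalarMeasure f)) atTop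
      (𝓝 0) := by
    have h := hσ.ennrpow_const (1 / 2)
    rw [ENNReal.zero_rpow_of_pos (by norm_num)] at h
    refine h.congr fun n => ?_
    rw [lintegral_ofReal_sq_eq_eLpNorm, ← ENNReal.rpow_natCast, ← ENNReal.rpow_mul]
    norm_num
  congr 1
  have hφm := hu.1
  simp only [h2] at h1
  apply le_antisymm
  · have h4 := h3.add_const (eLpNorm φ 2 (E.scalarMeasure f))
    rw [zero_add] at h4
    refine le_of_tendsto_of_tendsto' h1 h4 fun n => ?_
    have := eLpNorm_add_le (p := 2) (μ := E.scalarMeasure f)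
      (f := fun x => σ n x - φ x) (g := φ)
      ((σ n).measurable.sub hφm).aestronglyMeasurable hφm.aestronglyMeasurable (by simp)
    rwa [show (fun x => σ n x - φ x) + φ = σ n by ext x; simp] at this
  · have h4 := h3.add h1
    rw [zero_add] at h4
    refine le_of_tendsto_of_tendsto' tendsto_const_nhds h4 fun n => ?_
    have := eLpNorm_sub_le (p := 2) (μ := E.scalarMeasure f)
      (f := σ n) (g := fun x => σ n x - φ x) (σ n).measurable.aestronglyMeasurable
      ((σ n).measurable.sub hφm).aestronglyMeasurable (by simp)
    rw [add_comm]
    rwa [show (⇑(σ n) - fun x => σ n x - φ x) = φ by ext x; simp] at this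

theorem HasIntegral.inner_left {φ : ℝ → ℝ} {f g u v : H} (hu : E.HasIntegral φ f u)
    (hv : E.HasIntegral φ g v) : inner 𝕜 u g = inner 𝕜 f v := by
  -- Approximation in `L²` of the sum of the two scalar measures gives a single sequence that serves
  -- `f` and `g` at once.
  obtain ⟨σ, hσ⟩ := exists_simpleFunc_tendsto_sq (E.scalarMeasure f + E.scalarMeasure g) hu.1
    (by rw [lintegral_add_measure]; exact ENNReal.add_lt_top.2 ⟨hu.2.1, hv.2.1⟩)
  have h1 := hu.2.2 σ (tendsto_of_tendsto_of_tendsto_of_le_of_le tendsto_const_nhds hσ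
    (fun _ => zero_le) fun n => lintegral_mono' (Measure.le_add_right le_rfl) le_rfl)
  have h2 := hv.2.2 σ (tendsto_of_tendsto_of_tendsto_of_le_of_le tendsto_const_nhds hσ
    (fun _ => zero_le) fun n => lintegral_mono' (Measure.le_add_left le_rfl) le_rfl)
  have h3 := h1.inner (𝕜 := 𝕜) (tendsto_const_nhds (x := g))
  have h4 := (tendsto_const_nhds (x := f)).inner (𝕜 := 𝕜) h2
  simp only [E.inner_simpleIntegral_left] at h3
  exact tendsto_nhds_unique h3 h4

theorem HasIntegral.vec_add {φ : ℝ → ℝ} {f g u v : H} (hu : E.HasIntegral φ f u)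
    (hv : E.HasIntegral φ g v) : E.HasIntegral φ (f + g) (u + v) := by
  obtain ⟨σ, hσ⟩ := exists_simpleFunc_tendsto_sq (E.scalarMeasure f + E.scalarMeasure g) hu.1
    (by rw [lintegral_add_measure]; exact ENNReal.add_lt_top.2 ⟨hu.2.1, hv.2.1⟩)
  have h1 := hu.2.2 σ (tendsto_of_tendsto_of_tendsto_of_le_of_le tendsto_const_nhds hσ
    (fun _ => zero_le) fun n => lintegral_mono' (Measure.le_add_right le_rfl) le_rfl)
  have h2 := hv.2.2 σ (tendsto_of_tendsto_of_tendsto_of_le_of_le tendsto_const_nhds hσ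
    (fun _ => zero_le) fun n => lintegral_mono' (Measure.le_add_left le_rfl) le_rfl)
  refine hasIntegral_of_tendsto hu.1 (add_mem hu.2.1 hv.2.1) (σ := σ) ?_ ?_
  · have h3 := ENNReal.Tendsto.const_mul (a := 2) hσ (Or.inr (by simp))
    rw [mul_zero] at h3
    refine tendsto_of_tendsto_of_tendsto_of_le_of_le tendsto_const_nhds h3
      (fun _ => zero_le) fun n => ?_
    refine (lintegral_mono' (E.scalarMeasure_add_le f g) le_rfl).trans ?_
    rw [lintegral_smul_measure, smul_eq_mul]
  · simp only [E.simpleIntegral_vec_add]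
    exact h1.add h2

theorem HasIntegral.vec_smul {φ : ℝ → ℝ} {f u : H} (hu : E.HasIntegral φ f u) (c : 𝕜) :
    E.HasIntegral φ (c • f) (c • u) := by
  obtain ⟨σ, hσ⟩ := exists_simpleFunc_tendsto_sq (E.scalarMeasure f) hu.1 hu.2.1
  refine hasIntegral_of_tendsto hu.1 (Submodule.smul_mem _ c hu.2.1) (σ := σ) ?_ ?_
  · have h3 := ENNReal.Tendsto.const_mul (a := ENNReal.ofReal (‖c‖ ^ 2)) hσ (Or.inr (by simp))
    rw [mul_zero] at h3
    refine h3.congr fun n => ?_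
    rw [E.scalarMeasure_smul, lintegral_smul_measure, smul_eq_mul]
  · simp only [E.simpleIntegral_vec_smul]
    exact (hu.2.2 σ hσ).const_smul c

/-- Applying a simple function of the operator to `φ(A) f`. -/
theorem HasIntegral.simpleFunc_mul {φ : ℝ → ℝ} {f u : H} (hu : E.HasIntegral φ f u)
    (τ : SimpleFunc ℝ ℝ) : E.HasIntegral (fun x => τ x * φ x) f (E.simpleIntegral τ u) := by
  obtain ⟨σ, hσ⟩ := exists_simpleFunc_tendsto_sq (E.scalarMeasure f) hu.1 hu.2.1
  obtain ⟨C, hC⟩ := τ.exists_forall_norm_le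
  have hsq : ∀ x a : ℝ, ENNReal.ofReal ((τ x * a) ^ 2) ≤ ENNReal.ofReal (C ^ 2) *
      ENNReal.ofReal (a ^ 2) := fun x a => by
    rw [← ENNReal.ofReal_mul (by positivity), mul_pow]
    refine ENNReal.ofReal_le_ofReal (mul_le_mul_of_nonneg_right ?_ (by positivity))
    exact sq_le_sq' (by have := abs_le.1 (hC x); linarith) (abs_le.1 (hC x)).2
  refine hasIntegral_of_tendsto (τ.measurable.mul hu.1) ?_ (σ := fun n => τ * σ n) ?_ ?_
  · refine (lintegral_mono fun x => hsq x (φ x)).trans_lt ?_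
    rw [lintegral_const_mul' _ _ (by simp)]
    exact ENNReal.mul_lt_top (by simp) hu.2.1
  · have h2 := ENNReal.Tendsto.const_mul (a := ENNReal.ofReal (C ^ 2)) hσ (Or.inr (by simp))
    rw [mul_zero] at h2
    refine tendsto_of_tendsto_of_tendsto_of_le_of_le tendsto_const_nhds h2
      (fun _ => zero_le) fun n => ?_
    simp only
    rw [← lintegral_const_mul' _ _ (by simp)]
    refine lintegral_mono fun x => ?_
    rw [SimpleFunc.coe_mul, Pi.mul_apply, ← mul_sub]
    exact hsq x _
  · simp only [← E.simpleIntegral_comp]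
    exact ((E.continuous_simpleIntegral τ).tendsto u).comp (hu.2.2 σ hσ)

theorem simpleIntegral_indicator {B : Set ℝ} (hB : MeasurableSet B) (f : H) :
    E.simpleIntegral (SimpleFunc.piecewise B hB (SimpleFunc.const ℝ 1) (SimpleFunc.const ℝ 0)) f =
      E.proj B f := by
  classical
  -- Membership as a `Prop`-valued simple function makes `simpleIntegral_map` applicable, including
  -- when `B` is empty or everything and one value is missing from the range.
  let ρ : SimpleFunc ℝ Prop := ⟨(· ∈ B), fun p => by
    by_cases hp : p
    · convert hB; ext x; simp [hp]
    · convert hB.compl; ext x; simp [hp], Set.toFinite _⟩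
  have h1 := E.simpleIntegral_map ρ (fun p => if p then 1 else 0) f
  have h2 : ρ.map (fun p => if p then (1 : ℝ) else 0) =
      SimpleFunc.piecewise B hB (SimpleFunc.const ℝ 1) (SimpleFunc.const ℝ 0) := by
    ext x
    simp [ρ, Set.piecewise]
  rw [← h2, h1, Finset.sum_eq_single True]
  · simp [ρ]
  · intro p _ hp
    have : ¬ p := by simpa using hp
    simp [this]
  · intro hT
    have : ρ ⁻¹' {True} = ∅ := by
      ext x
      simp only [Set.mem_preimage, Set.mem_singleton_iff, Set.mem_empty_iff_false, iff_false]
      intro hx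
      exact hT (hx ▸ SimpleFunc.mem_range_self ρ x)
    rw [this, E.proj_empty, smul_zero]

theorem HasIntegral.proj {φ : ℝ → ℝ} {f u : H} (hu : E.HasIntegral φ f u) {B : Set ℝ}
    (hB : MeasurableSet B) : E.HasIntegral (B.indicator φ) f (E.proj B u) := by
  have h := hu.simpleFunc_mul
    (SimpleFunc.piecewise B hB (SimpleFunc.const ℝ 1) (SimpleFunc.const ℝ 0))
  rw [simpleIntegral_indicator] at h
  convert h using 1
  ext x
  by_cases hx : x ∈ B <;> simp [hx]

/-- `E(B) u` is `(1_B φ)(A) f`, so the isometry evaluates its squared norm as `∫_B φ² d‖E f‖²`. -/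
theorem HasIntegral.scalarMeasure_eq {φ : ℝ → ℝ} {f u : H} (hu : E.HasIntegral φ f u) :
    E.scalarMeasure u = (E.scalarMeasure f).withDensity fun x => ENNReal.ofReal (φ x ^ 2) := by
  refine Measure.ext fun B hB => ?_
  rw [E.scalarMeasure_apply _ hB, withDensity_apply _ hB, ENNReal.ofReal_pow (norm_nonneg _),
    ofReal_norm, (hu.proj hB).enorm_sq, ← lintegral_indicator hB]
  refine lintegral_congr fun x => ?_
  by_cases hx : x ∈ B <;> simp [hx]

theorem HasIntegral.lintegral_sq {φ ψ : ℝ → ℝ} {f u : H} (hu : E.HasIntegral φ f u)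
    (hψ : Measurable ψ) : ∫⁻ x, ENNReal.ofReal (ψ x ^ 2) ∂(E.scalarMeasure u) =
      ∫⁻ x, ENNReal.ofReal ((ψ x * φ x) ^ 2) ∂(E.scalarMeasure f) := by
  have hφ := hu.1
  rw [hu.scalarMeasure_eq, lintegral_withDensity_eq_lintegral_mul _ (by fun_prop) (by fun_prop)]
  refine lintegral_congr fun x => ?_
  rw [Pi.mul_apply, mul_pow, mul_comm, ENNReal.ofReal_mul (by positivity)]

/-- For `τ` simple, `τ(A) u - v` is `((τ - ψ) φ)(A) f`. Since `d‖E u‖²` has density `φ²` with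
respect to `d‖E f‖²`, its norm is the distance from `τ` to `ψ` in `L²(d‖E u‖²)`, so approximating
`ψ` there forces convergence to `v`. -/
theorem HasIntegral.comp {φ ψ : ℝ → ℝ} {f u v : H} (hu : E.HasIntegral φ f u)
    (hψ : Measurable ψ) (hv : E.HasIntegral (fun x => ψ x * φ x) f v) :
    E.HasIntegral ψ u v := by
  have hdom : u ∈ E.domain ψ := by
    change ∫⁻ x, ENNReal.ofReal (ψ x ^ 2) ∂(E.scalarMeasure u) < ⊤
    rw [hu.lintegral_sq hψ]
    exact hv.2.1
  obtain ⟨τ, hτ⟩ := exists_simpleFunc_tendsto_sq (E.scalarMeasure u) hψ hdom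
  refine hasIntegral_of_tendsto hψ hdom hτ ?_
  apply tendsto_of_tendsto_enorm_sq
  refine hτ.congr fun n => ?_
  have h1 := (hu.simpleFunc_mul (τ n)).add (hv.const_mul (-1))
  have h2 := h1.enorm_sq
  have h3 := hu.lintegral_sq ((τ n).measurable.sub hψ)
  simp only [Pi.sub_apply] at h3
  rw [h3]
  simp only [RCLike.ofReal_neg, RCLike.ofReal_one, neg_smul, one_smul, ← sub_eq_add_neg] at h2
  rw [h2]
  refine lintegral_congr fun x => ?_
  congr 2
  ring

end SpectralMeasure

end SpectralCalculus

/-! ### Resolutions carried by the positive half-line -/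

section SpectralCalculus

variable {𝕜 H : Type*} [RCLike 𝕜] [NormedAddCommGroup H] [InnerProductSpace 𝕜 H] [CompleteSpace H]

namespace SpectralMeasure

variable {E : SpectralMeasure 𝕜 H}

theorem hasIntegral_one (f : H) : E.HasIntegral (fun _ => 1) f f := by
  have h := hasIntegral_simpleFunc (E := E) (SimpleFunc.piecewise Set.univ MeasurableSet.univ
    (SimpleFunc.const ℝ 1) (SimpleFunc.const ℝ 0)) f
  rw [simpleIntegral_indicator, E.proj_univ] at h
  convert h using 1
  · ext x
    simp
  · rfl

theorem ae_mem_of_proj_eq {B : Set ℝ} (hB : MeasurableSet B) {f : H} (h : E.proj Bᶜ f = 0) :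
    ∀ᵐ x ∂(E.scalarMeasure f), x ∈ B := by
  rw [ae_iff]
  change E.scalarMeasure f Bᶜ = 0
  rw [E.scalarMeasure_apply _ hB.compl, h]
  simp

theorem exists_hasIntegral_of_ae_bound {φ : ℝ → ℝ} {f : H} {C : ℝ} (hm : Measurable φ)
    (hb : ∀ᵐ x ∂(E.scalarMeasure f), |φ x| ≤ C) : ∃ u, E.HasIntegral φ f u := by
  refine exists_hasIntegral hm (lt_of_le_of_lt (lintegral_mono_ae (g := fun _ =>
    ENNReal.ofReal (C ^ 2)) ?_) ?_)
  · filter_upwards [hb] with x hx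
    refine ENNReal.ofReal_le_ofReal ?_
    rw [← sq_abs]
    exact pow_le_pow_left₀ (abs_nonneg _) hx 2
  · rw [lintegral_const]
    exact ENNReal.mul_lt_top (by simp) (measure_lt_top _ _)

theorem HasIntegral.enorm_le {φ ψ : ℝ → ℝ} {f u v : H} (hu : E.HasIntegral φ f u)
    (hv : E.HasIntegral ψ f v) {M : ℝ} (h : ∀ᵐ x ∂(E.scalarMeasure f), |φ x| ≤ M * |ψ x|) :
    ‖u‖ₑ ≤ ENNReal.ofReal M * ‖v‖ₑ := by
  refine (ENNReal.pow_right_strictMono (n := 2) (by simp)).le_iff_le.1 ?_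
  rw [mul_pow, hu.enorm_sq, hv.enorm_sq, ← lintegral_const_mul' _ _ (by simp)]
  refine lintegral_mono_ae ?_
  filter_upwards [h] with x hx
  have e : ∀ y : ℝ, ENNReal.ofReal (y ^ 2) = ENNReal.ofReal |y| ^ 2 := fun y => by
    rw [← sq_abs, ENNReal.ofReal_pow (abs_nonneg _)]
  rw [e, e, ← mul_pow, ← ENNReal.ofReal_mul' (abs_nonneg _)]
  gcongr

/-- The spectral resolution of a nonnegative injective operator. -/
def IsPositive (E : SpectralMeasure 𝕜 H) : Prop := E.proj (Set.Iic 0) = 0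

theorem IsPositive.ae_pos (hE : E.IsPositive) (f : H) :
    ∀ᵐ x ∂(E.scalarMeasure f), 0 < x := by
  refine ae_mem_of_proj_eq (B := Set.Ioi 0) measurableSet_Ioi ?_
  rw [Set.compl_Ioi, hE]
  rfl

/-- The vector `φ(A) f` (arbitrary if `f` is not in the domain of `φ(A)`). -/
def fc (E : SpectralMeasure 𝕜 H) (φ : ℝ → ℝ) (f : H) : H :=
  Classical.epsilon fun u => E.HasIntegral φ f u

theorem IsPositive.hasIntegral_fc (hE : E.IsPositive) {φ : ℝ → ℝ} {C : ℝ} (hm : Measurable φ)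
    (hb : ∀ x, 0 < x → |φ x| ≤ C) (f : H) : E.HasIntegral φ f (E.fc φ f) :=
  Classical.epsilon_spec (exists_hasIntegral_of_ae_bound hm
    ((hE.ae_pos f).mono fun x hx => hb x hx))

theorem IsPositive.enorm_le (hE : E.IsPositive) {φ ψ : ℝ → ℝ} {f u v : H}
    (hu : E.HasIntegral φ f u) (hv : E.HasIntegral ψ f v) {M : ℝ}
    (h : ∀ x, 0 < x → |φ x| ≤ M * |ψ x|) : ‖u‖ₑ ≤ ENNReal.ofReal M * ‖v‖ₑ :=
  hu.enorm_le hv ((hE.ae_pos f).mono fun x hx => h x hx)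

theorem IsPositive.congr (hE : E.IsPositive) {φ ψ : ℝ → ℝ} {f u : H} (hu : E.HasIntegral φ f u)
    (hm : Measurable ψ) (h : ∀ x, 0 < x → φ x = ψ x) : E.HasIntegral ψ f u :=
  hu.congr hm ((hE.ae_pos f).mono fun x hx => h x hx)

/-- If `∫ φ² d‖E f‖² = 0` while `φ` never vanishes on the support, the scalar measure is zero, and
its total mass is `‖f‖²`. -/
theorem IsPositive.eq_zero_of_hasIntegral (hE : E.IsPositive) {φ : ℝ → ℝ} {f : H}
    (hu : E.HasIntegral φ f 0) (h : ∀ x, 0 < x → φ x ≠ 0) : f = 0 := by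
  have h1 := hu.enorm_sq
  have hm := hu.1
  rw [enorm_zero, zero_pow two_ne_zero, eq_comm, lintegral_eq_zero_iff (by fun_prop)] at h1
  have h2 : ∀ᵐ x ∂(E.scalarMeasure f), False := by
    filter_upwards [h1, hE.ae_pos f] with x hx hx0
    have : 0 < φ x ^ 2 := by have := h x hx0; positivity
    simp only [Pi.zero_apply, ENNReal.ofReal_eq_zero] at hx
    linarith
  rw [ae_iff] at h2
  simp only [not_false_eq_true] at h2
  have h3 := E.scalarMeasure_univ f
  rw [show {x : ℝ | True} = Set.univ by simp] at h2
  rw [h2] at h3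
  simpa using h3.symm

/-- Differentiation of `φ(t, A) h` with respect to the parameter. -/
theorem IsPositive.hasDerivAt [NormedSpace ℝ H] [IsScalarTower ℝ 𝕜 H] (hE : E.IsPositive)
    {φ φ' : ℝ → ℝ → ℝ} {w : ℝ → H} {h w' : H} {t₀ δ C : ℝ} (hδ : 0 < δ)
    (hw : ∀ t ∈ Metric.ball t₀ δ, E.HasIntegral (φ t) h (w t))
    (hw' : E.HasIntegral (φ' t₀) h w')
    (hd : ∀ t ∈ Metric.ball t₀ δ, ∀ x, 0 < x → HasDerivAt (fun t => φ t x) (φ' t x) t)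
    (hb : ∀ t ∈ Metric.ball t₀ δ, ∀ x, 0 < x → |φ' t x| ≤ C) : HasDerivAt w w' t₀ := by
  rw [hasDerivAt_iff_tendsto_slope]
  have h0 : t₀ ∈ Metric.ball t₀ δ := Metric.mem_ball_self hδ
  have hball : Metric.ball t₀ δ ∈ 𝓝[≠] t₀ := nhdsWithin_le_nhds (Metric.ball_mem_nhds _ hδ)
  apply tendsto_of_tendsto_enorm_sq
  have hint : ∀ t ∈ Metric.ball t₀ δ, E.HasIntegral
      (fun x => (t - t₀)⁻¹ * (φ t x + -1 * φ t₀ x) + -1 * φ' t₀ x) h (slope w t₀ t - w') := by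
    intro t ht
    have h1 := (((hw t ht).add ((hw t₀ h0).const_mul (-1))).const_mul ((t - t₀)⁻¹)).add
      (hw'.const_mul (-1))
    convert h1 using 1
    rw [slope_def_module, RCLike.real_smul_eq_coe_smul (K := 𝕜)]
    simp [sub_eq_add_neg]
  have hlim : Tendsto (fun t => ∫⁻ x, ENNReal.ofReal
      (((t - t₀)⁻¹ * (φ t x + -1 * φ t₀ x) + -1 * φ' t₀ x) ^ 2) ∂(E.scalarMeasure h))
      (𝓝[≠] t₀) (𝓝 (∫⁻ _, 0 ∂(E.scalarMeasure h))) := by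
    -- The mean value inequality bounds the difference quotient by `C`, and the derivative itself is
    -- bounded by `C`; the constant `(2C)²` is integrable because the scalar measure is finite.
    refine tendsto_lintegral_filter_of_dominated_convergence
      (fun _ => ENNReal.ofReal ((2 * C) ^ 2)) ?_ ?_ ?_ ?_
    · filter_upwards [hball] with t ht
      have := (hint t ht).1
      fun_prop
    · filter_upwards [hball] with t ht
      filter_upwards [hE.ae_pos h] with x hx
      refine ENNReal.ofReal_le_ofReal ?_
      have h1 : |φ t x - φ t₀ x| ≤ C * |t - t₀| := by
        have := (convex_ball t₀ δ).norm_image_sub_le_of_norm_hasDerivWithin_le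
          (f := fun t => φ t x) (f' := fun t => φ' t x) (C := C)
          (fun t ht => (hd t ht x hx).hasDerivWithinAt) (fun t ht => hb t ht x hx) h0 ht
        simpa using this
      have hC : 0 ≤ C := (abs_nonneg _).trans (hb t₀ h0 x hx)
      have h2 : |(t - t₀)⁻¹ * (φ t x + -1 * φ t₀ x)| ≤ C := by
        rw [abs_mul, abs_inv, neg_one_mul, ← sub_eq_add_neg]
        by_cases htt : t - t₀ = 0
        · simp [htt, hC]
        · rw [inv_mul_le_iff₀ (abs_pos.2 htt), mul_comm]
          exact h1
      have h3 := hb t₀ h0 x hx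
      rw [abs_le] at h2 h3
      exact sq_le_sq' (by linarith) (by linarith)
    · rw [lintegral_const]
      exact (ENNReal.mul_lt_top (by simp) (measure_lt_top _ _)).ne
    · filter_upwards [hE.ae_pos h] with x hx
      have h1 := (hasDerivAt_iff_tendsto_slope.1 (hd t₀ h0 x hx)).sub_const (φ' t₀ x)
      have h2 := ENNReal.tendsto_ofReal (h1.pow 2)
      simp only [sub_self, ne_eq, OfNat.ofNat_ne_zero, not_false_eq_true, zero_pow,
        ENNReal.ofReal_zero] at h2
      refine h2.congr fun t => ?_
      rw [slope_def_field]
      congr 2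
      rw [div_eq_inv_mul]
      ring
  rw [lintegral_zero] at hlim
  refine hlim.congr' ?_
  filter_upwards [hball] with t ht
  rw [(hint t ht).enorm_sq]

end SpectralMeasure

end SpectralCalculus

/-! ### Powers, exponentials and Bessel symbols -/

/-- Raise `z ≤ e^z`, with `z = εy/p`, to the power `p`. -/
theorem Real.exists_rpow_le_mul_exp (p : ℝ) {ε : ℝ} (hε : 0 < ε) (hp : 0 ≤ p) :
    ∃ C : ℝ, 0 < C ∧ ∀ y : ℝ, 0 ≤ y → y ^ p ≤ C * Real.exp (ε * y) := by
  rcases hp.eq_or_lt with rfl | hp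
  · refine ⟨1, one_pos, fun y hy => ?_⟩
    rw [Real.rpow_zero, one_mul]
    exact Real.one_le_exp (by positivity)
  · refine ⟨(p / ε) ^ p, by positivity, fun y hy => ?_⟩
    have h1 : y = (p / ε) * (ε * y / p) := by field_simp
    have h2 : ε * y / p ≤ Real.exp (ε * y / p) := by
      linarith [Real.add_one_le_exp (ε * y / p)]
    calc y ^ p = (p / ε) ^ p * (ε * y / p) ^ p := by
          rw [← Real.mul_rpow (by positivity) (by positivity), ← h1]
      _ ≤ (p / ε) ^ p * (Real.exp (ε * y / p)) ^ p := by gcongr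
      _ = (p / ε) ^ p * Real.exp (ε * y) := by
          rw [← Real.exp_mul]; congr 2; field_simp

theorem measurable_besselSymbol (r : ℝ) : Measurable (besselSymbol r) := by
  unfold besselSymbol
  fun_prop

theorem besselSymbol_pos (r : ℝ) {x : ℝ} (hx : 0 < x) : 0 < besselSymbol r x :=
  Real.rpow_pos_of_pos (by linarith) _

theorem besselSymbol_mul (r r' : ℝ) {x : ℝ} (hx : 0 < x) :
    besselSymbol r x * besselSymbol r' x = besselSymbol (r + r') x := by
  unfold besselSymbol
  rw [← Real.rpow_add (by linarith), add_div]

theorem besselSymbol_zero (x : ℝ) : besselSymbol 0 x = 1 := by simp [besselSymbol]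

theorem besselSymbol_mono {r r' : ℝ} (h : r ≤ r') {x : ℝ} (hx : 0 < x) :
    besselSymbol r x ≤ besselSymbol r' x :=
  Real.rpow_le_rpow_of_exponent_le (by linarith) (by linarith)

theorem besselSymbol_le_one {r : ℝ} (h : r ≤ 0) {x : ℝ} (hx : 0 < x) : besselSymbol r x ≤ 1 :=
  (besselSymbol_mono h hx).trans_eq (besselSymbol_zero x)

/-- Exponential decay beats any power, so the heat semigroup composed with `(I + A)^{r/2}` is
bounded on `L²` for every real `r`. -/
theorem exists_exp_mul_besselSymbol_le (r : ℝ) {τ : ℝ} (hτ : 0 < τ) :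
    ∃ C : ℝ, ∀ x, 0 < x → |Real.exp (-(τ * x)) * besselSymbol r x| ≤ C := by
  obtain ⟨C, hC, h⟩ := Real.exists_rpow_le_mul_exp (max r 0 / 2) hτ (by positivity)
  refine ⟨C * Real.exp τ, fun x hx => ?_⟩
  rw [abs_of_pos (mul_pos (Real.exp_pos _) (besselSymbol_pos r hx))]
  calc Real.exp (-(τ * x)) * besselSymbol r x
      ≤ Real.exp (-(τ * x)) * besselSymbol (max r 0) x := by
        gcongr; exact besselSymbol_mono (le_max_left _ _) hx
    _ ≤ Real.exp (-(τ * x)) * (C * Real.exp (τ * (1 + x))) := by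
        gcongr; exact h (1 + x) (by linarith)
    _ = C * Real.exp τ := by
        rw [mul_left_comm, ← Real.exp_add]; congr 2; ring

/-! ### Interpolation and the heat semigroup on `L^q` -/

section Interpolation

variable {X F : Type*} [MeasurableSpace X] {μ : Measure X} [NormedAddCommGroup F]

/-- Hölder's inequality combined with the interpolation of `L^{q'}` between `L²` and `L^∞`. -/
theorem lintegral_enorm_mul_le_of_interpolation {v f : X → F} (hv : AEStronglyMeasurable v μ)
    (hf : AEStronglyMeasurable f μ) {q : ℝ} (hq1 : 1 ≤ q) (hq2 : q ≤ 2) :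
    ∫⁻ x, ‖v x‖ₑ * ‖f x‖ₑ ∂μ ≤
      eLpNorm v ⊤ μ ^ (2 / q - 1) * eLpNorm v 2 μ ^ (2 - 2 / q) *
        eLpNorm f (ENNReal.ofReal q) μ := by
  have hq0 : 0 < q := by linarith
  have hθ : 0 ≤ 2 / q - 1 := by rw [sub_nonneg, le_div_iff₀ hq0]; linarith
  have hθ' : 0 ≤ 2 - 2 / q := by rw [sub_nonneg, div_le_iff₀ hq0]; linarith
  have hsplit : ∫⁻ x, ‖v x‖ₑ * ‖f x‖ₑ ∂μ ≤
      eLpNorm v ⊤ μ ^ (2 / q - 1) * ∫⁻ x, ‖v x‖ₑ ^ (2 - 2 / q) * ‖f x‖ₑ ∂μ := by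
    have hm : AEMeasurable (fun x => ‖v x‖ₑ ^ (2 - 2 / q) * ‖f x‖ₑ) μ :=
      (hv.enorm.pow_const _).mul hf.enorm
    rw [← lintegral_const_mul'' _ hm]
    refine lintegral_mono_ae ?_
    filter_upwards [enorm_ae_le_eLpNormEssSup v μ] with x hx
    rw [← mul_assoc, eLpNorm_exponent_top]
    gcongr
    -- The first factor is bounded by the supremum norm; the second is left for Hölder's inequality.
    calc ‖v x‖ₑ = ‖v x‖ₑ ^ ((2 / q - 1) + (2 - 2 / q)) := by
          rw [show (2 / q - 1) + (2 - 2 / q) = 1 by ring, ENNReal.rpow_one]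
      _ = ‖v x‖ₑ ^ (2 / q - 1) * ‖v x‖ₑ ^ (2 - 2 / q) :=
          ENNReal.rpow_add_of_nonneg _ _ hθ hθ'
      _ ≤ _ := by gcongr
  refine hsplit.trans ?_
  rw [mul_assoc]
  gcongr
  rw [eLpNorm_eq_lintegral_rpow_enorm_toReal (p := ENNReal.ofReal q) (by simpa using hq0) (by simp),
    ENNReal.toReal_ofReal hq0.le]
  rcases hq1.eq_or_lt with rfl | hq1
  -- At `q = 1` there is no finite conjugate exponent, but the power `2 - 2/q` of `‖v‖` is zero.
  · norm_num
  · have hc : (Real.conjExponent q).HolderConjugate q := (Real.HolderConjugate.conjExponent hq1).symm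
    refine (ENNReal.lintegral_mul_le_Lp_mul_Lq μ hc
      (f := fun x => ‖v x‖ₑ ^ (2 - 2 / q)) (g := fun x => ‖f x‖ₑ)
      (hv.enorm.pow_const _) hf.enorm).trans ?_
    gcongr
    -- The exponent is tuned so that Hölder's inequality produces exactly the `L²` norm of `v`.
    have he : (2 - 2 / q) * Real.conjExponent q = 2 := by
      unfold Real.conjExponent
      have : q - 1 ≠ 0 := by linarith
      field_simp
    rw [eLpNorm_eq_lintegral_rpow_enorm_toReal (by simp) (by simp), ← ENNReal.rpow_mul]
    simp only [← ENNReal.rpow_mul, he, ENNReal.toReal_ofNat]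
    apply le_of_eq
    congr 1
    rw [div_eq_iff hc.pos.ne', mul_assoc, he]
    norm_num

end Interpolation

section Lebesgue

variable {X 𝕜 : Type*} [RCLike 𝕜] [MeasurableSpace X] {μ : Measure X}

namespace SpectralMeasure

variable {E : SpectralMeasure 𝕜 (Lp 𝕜 2 μ)}

/-- The bound `‖e^{-tA} f‖_{L^∞} ≤ C t^{-α} ‖f‖_{L²}` for the operator with resolution `E`. -/
def HeatBound (E : SpectralMeasure 𝕜 (Lp 𝕜 2 μ)) (α C : ℝ) : Prop :=
  ∀ t : ℝ, 0 < t → ∀ f u : Lp 𝕜 2 μ, E.HasIntegral (fun x => Real.exp (-(t * x))) f u →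
    eLpNorm u ⊤ μ ≤ ENNReal.ofReal (C * t ^ (-α)) * ‖f‖ₑ

/-- A vector in the range of `E((-∞, 0])` is `e^{-tA} f` with `‖f‖ ≤ ‖u‖` for all `t > 0`, so that
the decay of the heat semigroup forces it to vanish. -/
theorem HeatBound.isPositive {α C : ℝ} (hα : 0 < α) (hE : E.HeatBound α C) : E.IsPositive := by
  ext1 g
  set u := E.proj (Set.Iic 0) g with hu
  have hsupp : ∀ᵐ x ∂(E.scalarMeasure u), x ∈ Set.Iic (0 : ℝ) := by
    refine ae_mem_of_proj_eq measurableSet_Iic ?_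
    rw [hu]
    exact E.proj_comp_of_disjoint measurableSet_Iic.compl measurableSet_Iic
      disjoint_compl_left g
  have key : ∀ t : ℝ, 0 < t → eLpNorm u ⊤ μ ≤ ENNReal.ofReal (C * t ^ (-α)) * ‖u‖ₑ := by
    intro t ht
    have hle : ∀ᵐ x ∂(E.scalarMeasure u), |Real.exp (t * x)| ≤ 1 := by
      filter_upwards [hsupp] with x hx
      rw [Real.abs_exp, Real.exp_le_one_iff]
      exact mul_nonpos_of_nonneg_of_nonpos ht.le hx
    obtain ⟨f, hf⟩ := exists_hasIntegral_of_ae_bound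
      (φ := fun x => Real.exp (t * x)) (by fun_prop) hle
    have hfu : ‖f‖ₑ ≤ ‖u‖ₑ := by
      have := hf.enorm_le (hasIntegral_one u) (M := 1) (hle.mono fun x hx => by simpa using hx)
      simpa using this
    have hback : E.HasIntegral (fun x => Real.exp (-(t * x))) f u := by
      refine hf.comp (by fun_prop) ?_
      convert hasIntegral_one (E := E) u using 2 with x
      rw [← Real.exp_add]
      simp
    exact (hE t ht f u hback).trans (by gcongr)
  have hlim : Tendsto (fun t : ℝ => ENNReal.ofReal (C * t ^ (-α)) * ‖u‖ₑ) atTop (𝓝 0) := by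
    have h1 := (tendsto_rpow_neg_atTop hα).const_mul C
    have h2 := ENNReal.Tendsto.mul_const (b := ‖u‖ₑ) (ENNReal.tendsto_ofReal h1)
      (Or.inr enorm_ne_top)
    simpa using h2
  have h0 : eLpNorm u ⊤ μ = 0 := by
    refine le_antisymm (ge_of_tendsto hlim ?_) zero_le
    filter_upwards [eventually_gt_atTop 0] with t ht using key t ht
  have h1 : (u : X → 𝕜) =ᵐ[μ] 0 :=
    (eLpNorm_eq_zero_iff (Lp.aestronglyMeasurable u) (by simp)).1 h0
  exact (Lp.eq_zero_iff_ae_eq_zero).2 h1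

theorem IsPositive.hasIntegral_exp (hE : E.IsPositive) {τ : ℝ} (hτ : 0 < τ) (g : Lp 𝕜 2 μ) :
    E.HasIntegral (fun x => Real.exp (-(τ * x))) g (E.fc (fun x => Real.exp (-(τ * x))) g) :=
  hE.hasIntegral_fc (C := 1) (by fun_prop) (fun x hx => by
    rw [Real.abs_exp, Real.exp_le_one_iff, neg_nonpos]; positivity) g

theorem IsPositive.hasIntegral_exp_mul_bessel (hE : E.IsPositive) (γ : ℝ) {τ : ℝ} (hτ : 0 < τ)
    (g : Lp 𝕜 2 μ) :
    E.HasIntegral (fun x => Real.exp (-(τ * x)) * besselSymbol γ x) g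
      (E.fc (fun x => Real.exp (-(τ * x)) * besselSymbol γ x) g) := by
  obtain ⟨C, hC⟩ := exists_exp_mul_besselSymbol_le γ hτ
  have := measurable_besselSymbol γ
  exact hE.hasIntegral_fc (by fun_prop) hC g

/-- `f = (I + A)^{-γ/2} h` in the sense of the pairing with the range of the heat semigroup. -/
def Represents (E : SpectralMeasure 𝕜 (Lp 𝕜 2 μ)) (γ : ℝ) (f : X → 𝕜) (h : Lp 𝕜 2 μ) : Prop :=
  ∀ τ : ℝ, 0 < τ → ∀ g : Lp 𝕜 2 μ,
    inner 𝕜 g (E.fc (fun x => Real.exp (-(τ * x)) * besselSymbol (-γ) x) h) =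
      ∫ x, inner 𝕜 (E.fc (fun x => Real.exp (-(τ * x))) g x) (f x) ∂μ

/-- The pairings determine `e^{-A} (I + A)^{-γ/2} h`, and the symbol of that operator has no zero on
`(0, ∞)`, so `h` is determined too. -/
theorem Represents.unique (hE : E.IsPositive) {γ : ℝ} {f : X → 𝕜} {h h' : Lp 𝕜 2 μ}
    (hh : E.Represents γ f h) (hh' : E.Represents γ f h') : h = h' := by
  have h1 := hE.hasIntegral_exp_mul_bessel (-γ) one_pos h
  have h2 := hE.hasIntegral_exp_mul_bessel (-γ) one_pos h'
  have he : E.fc (fun x => Real.exp (-(1 * x)) * besselSymbol (-γ) x) h =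
      E.fc (fun x => Real.exp (-(1 * x)) * besselSymbol (-γ) x) h' :=
    ext_inner_left 𝕜 fun g => (hh 1 one_pos g).trans (hh' 1 one_pos g).symm
  rw [← he] at h2
  have h3 := h1.vec_add (h2.vec_smul (-1))
  rw [neg_one_smul, neg_one_smul, add_neg_cancel, ← sub_eq_add_neg] at h3
  exact sub_eq_zero.1 (hE.eq_zero_of_hasIntegral h3 fun x hx =>
    (mul_pos (Real.exp_pos _) (besselSymbol_pos _ hx)).ne')

/-- The `L^q → L²` bound for the heat semigroup, by duality. -/
theorem Represents.enorm_heat_le {α C : ℝ} (hE : E.IsPositive) (hH : E.HeatBound α C)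
    {γ q : ℝ} (hq1 : 1 ≤ q) (hq2 : q ≤ 2) {f : X → 𝕜} (hf : MemLp f (ENNReal.ofReal q) μ)
    {h : Lp 𝕜 2 μ} (hh : E.Represents γ f h) {τ : ℝ} (hτ : 0 < τ) :
    ‖E.fc (fun x => Real.exp (-(τ * x)) * besselSymbol (-γ) x) h‖ₑ ≤
      ENNReal.ofReal (C * τ ^ (-α)) ^ (2 / q - 1) * eLpNorm f (ENNReal.ofReal q) μ := by
  set u := E.fc (fun x => Real.exp (-(τ * x)) * besselSymbol (-γ) x) h with hu
  set v := E.fc (fun x => Real.exp (-(τ * x))) u with hv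
  have hq0 : 0 < q := by linarith
  have hθ : 0 ≤ 2 / q - 1 := by rw [sub_nonneg, le_div_iff₀ hq0]; linarith
  have hθ' : 0 ≤ 2 - 2 / q := by rw [sub_nonneg, div_le_iff₀ hq0]; linarith
  have hvi := hE.hasIntegral_exp hτ u
  have hv2 : eLpNorm v 2 μ ≤ ‖u‖ₑ := by
    rw [← Lp.enorm_def]
    have := hE.enorm_le hvi (hasIntegral_one u) (M := 1) (fun x hx => by
      rw [Real.abs_exp, abs_one, mul_one, Real.exp_le_one_iff, neg_nonpos]; positivity)
    simpa using this
  have hvt : eLpNorm v ⊤ μ ≤ ENNReal.ofReal (C * τ ^ (-α)) * ‖u‖ₑ := hH τ hτ u v hvi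
  -- Testing the representation against `g = u` gives `‖u‖² = ∫ ⟨e^{-τA} u, f⟩`. After interpolation
  -- the right-hand side is linear in `‖u‖`, and one factor cancels.
  have h1 : ‖u‖ₑ * ‖u‖ₑ ≤ ∫⁻ x, ‖v x‖ₑ * ‖f x‖ₑ ∂μ := by
    have h2 := hh τ hτ u
    rw [← hu, ← hv, inner_self_eq_norm_sq_to_K] at h2
    have h3 : ‖u‖ₑ * ‖u‖ₑ = ‖((‖u‖ : 𝕜) ^ 2)‖ₑ := by
      rw [enorm_pow, ← sq, ← ofReal_norm, ← ofReal_norm, RCLike.norm_ofReal, abs_norm]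
    rw [h3, h2]
    refine (enorm_integral_le_lintegral_enorm _).trans (lintegral_mono fun x => ?_)
    have := norm_inner_le_norm (𝕜 := 𝕜) (v x) (f x)
    rw [← ofReal_norm, ← ofReal_norm, ← ofReal_norm, ← ENNReal.ofReal_mul (norm_nonneg _)]
    exact ENNReal.ofReal_le_ofReal this
  have h4 := h1.trans (lintegral_enorm_mul_le_of_interpolation (Lp.aestronglyMeasurable v)
    hf.1 hq1 hq2)
  have h5 : ‖u‖ₑ * ‖u‖ₑ ≤ ‖u‖ₑ * (ENNReal.ofReal (C * τ ^ (-α)) ^ (2 / q - 1) *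
      eLpNorm f (ENNReal.ofReal q) μ) := by
    refine h4.trans ?_
    calc _ ≤ (ENNReal.ofReal (C * τ ^ (-α)) * ‖u‖ₑ) ^ (2 / q - 1) * ‖u‖ₑ ^ (2 - 2 / q) *
          eLpNorm f (ENNReal.ofReal q) μ := by gcongr
      _ = _ := by
        rw [ENNReal.mul_rpow_of_nonneg _ _ hθ]
        have : ‖u‖ₑ ^ (2 / q - 1) * ‖u‖ₑ ^ (2 - 2 / q) = ‖u‖ₑ := by
          rw [← ENNReal.rpow_add_of_nonneg _ _ hθ hθ', show (2 / q - 1) + (2 - 2 / q) = 1 by ring,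
            ENNReal.rpow_one]
        rw [mul_assoc (_ ^ _) (_ ^ _) (_ ^ (2 - 2 / q)), this]
        ring
  rcases eq_or_ne ‖u‖ₑ 0 with h0 | h0
  · rw [h0]; exact zero_le
  · exact (ENNReal.mul_le_mul_iff_right h0 enorm_ne_top).1 h5

end SpectralMeasure

end Lebesgue

/-! ### Embedding of Sobolev spaces into `L^∞` -/

section Lebesgue

variable {X 𝕜 : Type*} [RCLike 𝕜] [MeasurableSpace X] {μ : Measure X}

theorem eLpNorm_coe_add_le {p : ℝ≥0∞} (hp : 1 ≤ p) (u v : Lp 𝕜 2 μ) :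
    eLpNorm (u + v : Lp 𝕜 2 μ) p μ ≤ eLpNorm u p μ + eLpNorm v p μ := by
  rw [eLpNorm_congr_ae (Lp.coeFn_add u v)]
  exact eLpNorm_add_le (Lp.aestronglyMeasurable u) (Lp.aestronglyMeasurable v) hp

theorem eLpNorm_coe_sum_le {p : ℝ≥0∞} (hp : 1 ≤ p) (u : ℕ → Lp 𝕜 2 μ) (n : ℕ) :
    eLpNorm (∑ i ∈ Finset.range n, u i : Lp 𝕜 2 μ) p μ ≤
      ∑ i ∈ Finset.range n, eLpNorm (u i) p μ := by
  induction n with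
  | zero =>
    rw [Finset.sum_range_zero, Finset.sum_range_zero, eLpNorm_congr_ae (Lp.coeFn_zero _ _ _)]
    simp
  | succ n ih =>
    rw [Finset.sum_range_succ, Finset.sum_range_succ]
    exact (eLpNorm_coe_add_le hp _ _).trans (by gcongr)

/-- Convergence in `L²` gives an almost everywhere convergent subsequence, along which Fatou's lemma
applies. -/
theorem eLpNorm_le_of_tendsto_Lp {p : ℝ≥0∞} {S : ℕ → Lp 𝕜 2 μ} {u : Lp 𝕜 2 μ} {K : ℝ≥0∞}
    (hS : Tendsto S atTop (𝓝 u)) (hK : ∀ n, eLpNorm (S n) p μ ≤ K) : eLpNorm u p μ ≤ K := by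
  obtain ⟨ns, -, hns⟩ := (tendstoInMeasure_of_tendsto_Lp hS).exists_seq_tendsto_ae
  exact Lp.eLpNorm_le_of_ae_tendsto (Eventually.of_forall fun n => hK (ns n))
    (fun n => Lp.aestronglyMeasurable _) hns

namespace SpectralMeasure

variable {E : SpectralMeasure 𝕜 (Lp 𝕜 2 μ)}

/-- The embedding of `H^σ(A)` into `L^∞` for `σ > 2α`, by a dyadic decomposition of the
spectrum. -/
theorem HeatBound.exists_eLpNorm_top_le {α C : ℝ} (hC : 0 < C) (hE : E.IsPositive)
    (hH : E.HeatBound α C) {σ : ℝ} (hσ0 : 0 ≤ σ) (hσ : 2 * α < σ) :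
    ∃ K : ℝ, 0 < K ∧ ∀ (ψ : ℝ → ℝ) (h u : Lp 𝕜 2 μ) (M : ℝ), 0 ≤ M →
      (∀ x, 0 < x → |ψ x| ≤ M * besselSymbol (-σ) x) → E.HasIntegral ψ h u →
      eLpNorm u ⊤ μ ≤ ENNReal.ofReal (K * M) * ‖h‖ₑ := by
  -- The ratio between consecutive dyadic pieces: `2^α` from the heat bound at time `2^{-j}`, and
  -- `2^{-σ/2}` from the decay of the symbol. It is below 1 exactly because `σ > 2α`.
  set ρ : ℝ := 2 ^ (α - σ / 2) with hρ
  have hρ0 : 0 < ρ := by positivity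
  have hρ1 : ρ < 1 := Real.rpow_lt_one_of_one_lt_of_neg (by norm_num) (by linarith)
  set K₀ : ℝ := C * Real.exp 1 * 2 ^ (σ / 2) with hK₀
  have hK₀pos : 0 < K₀ := by positivity
  refine ⟨K₀ * (1 - ρ)⁻¹, mul_pos hK₀pos (inv_pos.2 (by linarith)), fun ψ h u M hM hψ hu => ?_⟩
  set D : ℕ → Set ℝ := fun j => Set.Iic (2 ^ j) with hD
  have hDmono : Monotone D := fun i j hij =>
    Set.Iic_subset_Iic.2 (pow_le_pow_right₀ (by norm_num) hij)
  set B := disjointed D with hB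
  have hBmeas : ∀ j, MeasurableSet (B j) :=
    fun j => MeasurableSet.disjointed (fun i => measurableSet_Iic) j
  have hBle : ∀ j, ∀ x ∈ B j, x ≤ 2 ^ j := fun j x hx => disjointed_subset D j hx
  have hBge : ∀ j, ∀ x ∈ B j, 0 < x → (2 : ℝ) ^ j / 2 ≤ 1 + x := by
    intro j x hx hx0
    cases j with
    | zero => norm_num; linarith
    | succ i =>
      rw [hB, hDmono.disjointed_add_one] at hx
      have : ¬ x ≤ 2 ^ i := hx.2
      rw [pow_succ]
      linarith
  have hBU : ⋃ j, B j = Set.univ := by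
    rw [hB, iUnion_disjointed, Set.eq_univ_iff_forall]
    intro x
    obtain ⟨n, hn⟩ := pow_unbounded_of_one_lt x (one_lt_two)
    exact Set.mem_iUnion.2 ⟨n, hn.le⟩
  have hpiece : ∀ j, eLpNorm (E.proj (B j) u) ⊤ μ ≤ ENNReal.ofReal (K₀ * M * ρ ^ j) * ‖h‖ₑ := by
    intro j
    have hτ : (0 : ℝ) < (2 ^ j)⁻¹ := by positivity
    have hproj := hu.proj (hBmeas j)
    -- On the shell `x ≤ 2^j`, so `e^{-2^{-j} A}` can be divided out at the cost of a factor `e`.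
    have hb : ∀ x, 0 < x → |Real.exp ((2 ^ j)⁻¹ * x) * (B j).indicator ψ x| ≤
        Real.exp 1 * (M * (2 ^ j / 2) ^ (-σ / 2)) := by
      intro x hx
      by_cases hxB : x ∈ B j
      · rw [Set.indicator_of_mem hxB, abs_mul, Real.abs_exp]
        have h1 : (2 ^ j)⁻¹ * x ≤ 1 := by
          rw [inv_mul_le_iff₀ (by positivity), mul_one]
          exact hBle j x hxB
        have h2 : besselSymbol (-σ) x ≤ (2 ^ j / 2) ^ (-σ / 2) :=
          Real.rpow_le_rpow_of_nonpos (by positivity) (hBge j x hxB hx) (by linarith)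
        exact mul_le_mul (Real.exp_le_exp.2 h1) ((hψ x hx).trans (by gcongr)) (abs_nonneg _)
          (Real.exp_pos _).le
      · rw [Set.indicator_of_notMem hxB, mul_zero, abs_zero]
        positivity
    have hm : Measurable fun x => Real.exp ((2 ^ j)⁻¹ * x) * (B j).indicator ψ x :=
      (by fun_prop : Measurable fun x : ℝ => Real.exp ((2 ^ j)⁻¹ * x)).mul
        (hu.1.indicator (hBmeas j))
    have hg := hE.hasIntegral_fc hm hb h
    set g := E.fc (fun x => Real.exp ((2 ^ j)⁻¹ * x) * (B j).indicator ψ x) h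
    have hgle := hE.enorm_le hg (hasIntegral_one h) (fun x hx => by
      rw [abs_one, mul_one]; exact hb x hx)
    have hcomp : E.HasIntegral (fun x => Real.exp (-((2 ^ j)⁻¹ * x))) g (E.proj (B j) u) := by
      refine hg.comp (by fun_prop) ?_
      convert hproj using 2 with x
      rw [← mul_assoc, ← Real.exp_add]
      simp
    refine (hH _ hτ _ _ hcomp).trans ?_
    refine (mul_le_mul_right hgle _).trans_eq ?_
    rw [← mul_assoc, ← ENNReal.ofReal_mul (by positivity)]
    congr 2
    have e1 : ((2 : ℝ) ^ j)⁻¹ ^ (-α) = (2 ^ α) ^ j := by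
      rw [Real.inv_rpow (by positivity), Real.rpow_neg (by positivity), inv_inv,
        ← Real.rpow_natCast, ← Real.rpow_natCast, ← Real.rpow_mul (by norm_num),
        ← Real.rpow_mul (by norm_num), mul_comm]
    have e2 : ((2 : ℝ) ^ j / 2) ^ (-σ / 2) = (2 ^ (-σ / 2)) ^ j * 2 ^ (σ / 2) := by
      rw [Real.div_rpow (by positivity) (by norm_num), neg_div, Real.rpow_neg (x := 2) (by norm_num),
        div_inv_eq_mul, ← Real.rpow_neg (by norm_num),
        ← Real.rpow_natCast, ← Real.rpow_natCast, ← Real.rpow_mul (by norm_num),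
        ← Real.rpow_mul (by norm_num), mul_comm (j : ℝ)]
    have e3 : ρ ^ j = (2 ^ α) ^ j * (2 ^ (-σ / 2)) ^ j := by
      rw [← mul_pow, ← Real.rpow_add (by norm_num), hρ]
      congr 2
      ring
    rw [e1, e2, e3, hK₀]
    ring
  have hsum := (E.hasSum_iUnion B hBmeas (disjoint_disjointed D) u).tendsto_sum_nat
  rw [hBU, E.proj_univ] at hsum
  refine eLpNorm_le_of_tendsto_Lp hsum fun n => ?_
  refine (eLpNorm_coe_sum_le le_top _ n).trans ((Finset.sum_le_sum fun j _ => hpiece j).trans ?_)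
  rw [← Finset.sum_mul, ← ENNReal.ofReal_sum_of_nonneg (fun j _ => by positivity),
    ← Finset.mul_sum]
  refine mul_le_mul_left (ENNReal.ofReal_le_ofReal ?_) _
  have hgeo : ∑ j ∈ Finset.range n, ρ ^ j ≤ (1 - ρ)⁻¹ := by
    rw [← tsum_geometric_of_lt_one hρ0.le hρ1]
    exact (summable_geometric_of_lt_one hρ0.le hρ1).sum_le_tsum _ (fun j _ => by positivity)
  calc K₀ * M * ∑ j ∈ Finset.range n, ρ ^ j ≤ K₀ * M * (1 - ρ)⁻¹ := by gcongr
    _ = K₀ * (1 - ρ)⁻¹ * M := by ring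

end SpectralMeasure

open SpectralMeasure

/-! ### Elements of `H^γ(A)` as vectors of `L²` -/

section Representation

variable {A : Lp 𝕜 2 μ →ₗ.[𝕜] Lp 𝕜 2 μ}

theorem SpectralMeasure.IsPositive.hasIntegral_bessel_neg {E : SpectralMeasure 𝕜 (Lp 𝕜 2 μ)}
    (hE : E.IsPositive) {r : ℝ} {v y : Lp 𝕜 2 μ} (hv : E.HasIntegral (besselSymbol r) v y) :
    E.HasIntegral (besselSymbol (-r)) y v := by
  have hm := measurable_besselSymbol r
  have hm' := measurable_besselSymbol (-r)
  refine hv.comp hm' (hE.congr (hasIntegral_one v) (by fun_prop) fun x hx => ?_)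
  rw [besselSymbol_mul _ _ hx, neg_add_cancel, besselSymbol_zero]

theorem enorm_le_dualNorm_mul {r : ℝ} {F : sobolevSpace A r →ₗ⋆[𝕜] 𝕜} (hF : dualNorm A r F < ⊤)
    {v y : Lp 𝕜 2 μ} (hv : (spectralResolution A).HasIntegral (besselSymbol r) v y) :
    ‖F ⟨v, hv.2.1⟩‖ₑ ≤ dualNorm A r F * ‖y‖ₑ := by
  have h1 : sobolevNorm A r v ≤ ‖y‖ₑ := iInf₂_le y hv
  have h2 : ‖F ⟨v, hv.2.1⟩‖ₑ / sobolevNorm A r v ≤ dualNorm A r F :=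
    le_iSup (fun g : sobolevSpace A r => ‖F g‖ₑ / sobolevNorm A r (g : Lp 𝕜 2 μ)) ⟨v, hv.2.1⟩
  rw [ENNReal.div_le_iff_le_mul (Or.inr hF.ne) (Or.inl (h1.trans_lt enorm_lt_top).ne)] at h2
  exact h2.trans (by gcongr)

/-- Riesz representation in `H^{-r}(A)`. -/
theorem exists_represents_of_isDualElement {α C : ℝ} (hE : (spectralResolution A).IsPositive)
    (hH : (spectralResolution A).HeatBound α C) {r : ℝ} (hr : 0 < r) {f : X → 𝕜}
    {F : sobolevSpace A r →ₗ⋆[𝕜] 𝕜} (hF : IsDualElement A r f F) :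
    ∃ h : Lp 𝕜 2 μ, ‖h‖ₑ ≤ dualNorm A r F ∧
      (∀ v y, (hv : (spectralResolution A).HasIntegral (besselSymbol r) v y) →
        F ⟨v, hv.2.1⟩ = inner 𝕜 y h) ∧ (spectralResolution A).Represents (-r) f h := by
  set E := spectralResolution A with hEdef
  have hinv : ∀ y, E.HasIntegral (besselSymbol (-r)) y (E.fc (besselSymbol (-r)) y) := fun y =>
    hE.hasIntegral_fc (C := 1) (measurable_besselSymbol _) (fun x hx => by
      rw [abs_of_pos (besselSymbol_pos _ hx)]
      exact besselSymbol_le_one (by linarith) hx) y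
  have hinv' : ∀ y, E.HasIntegral (besselSymbol r) (E.fc (besselSymbol (-r)) y) y := fun y => by
    have := hE.hasIntegral_bessel_neg (hinv y)
    rwa [neg_neg] at this
  -- The isomorphism `(I + A)^{-r/2}` from `L²` onto `H^r(A)` transports `F` to `L²`; the
  -- conjugation makes it linear, as the Riesz theorem requires.
  let ℓ : Lp 𝕜 2 μ →ₗ[𝕜] 𝕜 :=
    { toFun := fun y => starRingEnd 𝕜 (F ⟨E.fc (besselSymbol (-r)) y, (hinv' y).2.1⟩)
      map_add' := fun y z => by
        rw [← map_add, ← map_add]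
        congr 2
        exact Subtype.ext ((hinv (y + z)).unique ((hinv y).vec_add (hinv z)))
      map_smul' := fun c y => by
        rw [show (⟨E.fc (besselSymbol (-r)) (c • y), (hinv' (c • y)).2.1⟩ : sobolevSpace A r) =
          c • ⟨E.fc (besselSymbol (-r)) y, (hinv' y).2.1⟩ from
          Subtype.ext ((hinv (c • y)).unique ((hinv y).vec_smul c)), map_smulₛₗ]
        simp }
  have hℓ : ∀ y, ‖ℓ y‖ ≤ (dualNorm A r F).toReal * ‖y‖ := fun y => by
    have h1 := enorm_le_dualNorm_mul hF.1 (hinv' y)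
    have h2 := ENNReal.toReal_mono (ENNReal.mul_ne_top hF.1.ne enorm_ne_top) h1
    rw [ENNReal.toReal_mul, toReal_enorm, toReal_enorm] at h2
    simpa [ℓ] using h2
  set h := (InnerProductSpace.toDual 𝕜 (Lp 𝕜 2 μ)).symm (ℓ.mkContinuous _ hℓ) with hh
  have hin : ∀ v y, (hv : E.HasIntegral (besselSymbol r) v y) →
      F ⟨v, hv.2.1⟩ = inner 𝕜 y h := by
    intro v y hv
    have h1 : inner 𝕜 h y = ℓ y := by
      rw [hh, InnerProductSpace.toDual_symm_apply]
      rfl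
    have h2 : v = E.fc (besselSymbol (-r)) y := (hE.hasIntegral_bessel_neg hv).unique (hinv y)
    rw [← inner_conj_symm, h1]
    subst h2
    simp [ℓ]
  refine ⟨h, ?_, hin, ?_⟩
  · have h1 : ‖h‖ ≤ (dualNorm A r F).toReal := by
      rw [hh, LinearIsometryEquiv.norm_map]
      exact ℓ.mkContinuous_norm_le ENNReal.toReal_nonneg hℓ
    rw [← ofReal_norm, ← ENNReal.ofReal_toReal hF.1.ne]
    exact ENNReal.ofReal_le_ofReal h1
  · intro τ hτ g
    have hmr := measurable_besselSymbol r
    have hexp := hE.hasIntegral_exp hτ g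
    have hsg := hE.hasIntegral_exp_mul_bessel r hτ g
    have hsh := hE.hasIntegral_exp_mul_bessel r hτ h
    have hv : E.HasIntegral (besselSymbol r) (E.fc (fun x => Real.exp (-(τ * x))) g)
        (E.fc (fun x => Real.exp (-(τ * x)) * besselSymbol r x) g) := by
      refine hexp.comp hmr ?_
      simpa only [mul_comm] using hsg
    have h1 := hin _ _ hv
    rw [neg_neg, ← hsg.inner_left hsh, ← h1]
    -- The heat bound puts `e^{-τA} g` in `L^∞`, so there `F` is the integral pairing with `f`.
    refine hF.2 _ ⟨Lp.aestronglyMeasurable _, ?_⟩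
    exact (hH τ hτ _ _ hexp).trans_lt (ENNReal.mul_lt_top (by simp) enorm_lt_top)

/-- The vector is `h = (I + A)^{γ/2} f` for `γ ≥ 0` and the Riesz vector of the functional for `γ <
0`. This treats both signs uniformly: `φ(A) f` becomes a bounded function of `A` applied to `h`. -/
theorem exists_represents {α C : ℝ} (hE : (spectralResolution A).IsPositive)
    (hH : (spectralResolution A).HeatBound α C) (γ : ℝ) {f : X → 𝕜}
    (hf : fnSobolevNorm A γ f < ⊤) :
    ∃ h : Lp 𝕜 2 μ, ‖h‖ₑ ≤ fnSobolevNorm A γ f ∧ (spectralResolution A).Represents γ f h ∧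
      ∀ φ : ℝ → ℝ, Measurable φ → (∃ M, ∀ x, 0 < x → |φ x * besselSymbol (-γ) x| ≤ M) →
        FnFuncCalc A γ φ f ((spectralResolution A).fc (fun x => φ x * besselSymbol (-γ) x) h) := by
  set E := spectralResolution A with hEdef
  rcases le_or_gt 0 γ with hγ | hγ
  · unfold fnSobolevNorm at hf ⊢
    rw [if_pos hγ] at hf ⊢
    obtain ⟨hf2, hf⟩ := iInf_lt_iff.1 hf
    rw [iInf_pos hf2]
    obtain ⟨h, hf⟩ := iInf_lt_iff.1 hf
    obtain ⟨hh, -⟩ := iInf_lt_iff.1 hf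
    have hh' : E.HasIntegral (besselSymbol γ) (hf2.toLp f) h := hh
    have hback := hE.hasIntegral_bessel_neg hh'
    refine ⟨h, le_iInf₂ fun u hu => by rw [hh'.unique hu], ?_, ?_⟩
    · intro τ hτ g
      have hsh := hE.hasIntegral_exp_mul_bessel (-γ) hτ h
      have hexp := hE.hasIntegral_exp hτ g
      have hz := hback.comp (ψ := fun x => Real.exp (-(τ * x))) (by fun_prop) hsh
      rw [← hexp.inner_left hz, L2.inner_def]
      refine integral_congr_ae ?_
      filter_upwards [hf2.coeFn_toLp] with x hx
      rw [hx]
    · intro φ hφ hb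
      obtain ⟨M, hM⟩ := hb
      refine ⟨fun _ => ⟨hf2, ?_⟩, fun h0 => absurd h0 hγ.not_gt⟩
      have hm := measurable_besselSymbol (-γ)
      exact hback.comp hφ (hE.hasIntegral_fc (by fun_prop) hM h)
  · unfold fnSobolevNorm at hf ⊢
    rw [if_neg hγ.not_ge] at hf ⊢
    obtain ⟨F, hf⟩ := iInf_lt_iff.1 hf
    obtain ⟨hF, -⟩ := iInf_lt_iff.1 hf
    obtain ⟨h, -, hin, hrep⟩ := exists_represents_of_isDualElement hE hH (neg_pos.2 hγ) hF
    rw [neg_neg] at hrep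
    refine ⟨h, le_iInf₂ fun F' hF' => ?_, hrep, ?_⟩
    -- The Sobolev norm is an infimum over functionals. Each candidate gives a Riesz vector
    -- representing the same `f`, and uniqueness identifies it with `h`.
    · obtain ⟨h', hle, -, hrep'⟩ := exists_represents_of_isDualElement hE hH (neg_pos.2 hγ) hF'
      rw [neg_neg] at hrep'
      rwa [hrep.unique hE hrep']
    · intro φ hφ hb
      obtain ⟨M, hM⟩ := hb
      have hm := measurable_besselSymbol (-γ)
      refine ⟨fun h0 => absurd h0 hγ.not_ge, fun _ => ⟨F, hF, fun g => ?_⟩⟩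
      have hφg : E.HasIntegral φ g (E.fc φ g) := by
        refine hE.hasIntegral_fc (C := M) hφ (fun x hx => ?_) g
        have h1 := hM x hx
        -- Since `-γ > 0`, the Bessel factor is at least 1, and boundedness of the product forces
        -- boundedness of `φ`.
        have h2 : 1 ≤ besselSymbol (-γ) x := by
          rw [← besselSymbol_zero x]
          exact besselSymbol_mono (by linarith) hx
        rw [abs_mul, abs_of_pos (besselSymbol_pos _ hx)] at h1
        nlinarith [abs_nonneg (φ x)]
      have hpg := hE.hasIntegral_fc (φ := fun x => φ x * besselSymbol (-γ) x) (by fun_prop) hM g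
      have hph := hE.hasIntegral_fc (φ := fun x => φ x * besselSymbol (-γ) x) (by fun_prop) hM h
      have hv : E.HasIntegral (besselSymbol (-γ)) (E.fc φ g)
          (E.fc (fun x => φ x * besselSymbol (-γ) x) g) := by
        refine hφg.comp hm ?_
        simpa only [mul_comm] using hpg
      refine ⟨⟨E.fc φ g, hv.2.1⟩, hφg, ?_⟩
      rw [hin _ _ hv, ← hpg.inner_left hph]

end Representation

end Lebesgue

/-! ### From symbol bounds to decay estimates -/

theorem one_le_japaneseBracket (t : ℝ) : 1 ≤ japaneseBracket t := by
  unfold japaneseBracket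
  rw [Real.one_le_sqrt]
  nlinarith [sq_nonneg t]

theorem japaneseBracket_le {t : ℝ} (ht : 0 < t) : japaneseBracket t ≤ 1 + t := by
  unfold japaneseBracket
  rw [Real.sqrt_le_left (by linarith)]
  nlinarith

theorem one_add_rpow_neg_le {t ρ : ℝ} (ht : 0 < t) (hρ : 0 ≤ ρ) :
    (1 + t) ^ (-ρ) ≤ japaneseBracket t ^ (-ρ) :=
  Real.rpow_le_rpow_of_nonpos (by linarith [one_le_japaneseBracket t]) (japaneseBracket_le ht)
    (by linarith)

theorem exists_exp_neg_le_rpow_neg {ε ρ : ℝ} (hε : 0 < ε) (hρ : 0 ≤ ρ) :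
    ∃ C : ℝ, 0 < C ∧ ∀ t : ℝ, 0 < t → Real.exp (-(ε * t)) ≤ C * (1 + t) ^ (-ρ) := by
  obtain ⟨C, hC, h⟩ := Real.exists_rpow_le_mul_exp ρ hε hρ
  refine ⟨C * Real.exp ε, by positivity, fun t ht => ?_⟩
  have h1 := h (1 + t) (by linarith)
  rw [Real.rpow_neg (by linarith), ← div_eq_mul_inv, le_div_iff₀ (by positivity)]
  calc Real.exp (-(ε * t)) * (1 + t) ^ ρ ≤ Real.exp (-(ε * t)) * (C * Real.exp (ε * (1 + t))) := by
        gcongr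
    _ = C * Real.exp ε := by rw [mul_left_comm, ← Real.exp_add]; congr 2; ring

/-- Bounds for a family of symbols `m t`, with `k`-th time derivative `dm t` split into a part
`lo t` controlled by the heat semigroup and an exponentially decaying part `hi t` of order `γ₀`. -/
structure SymbolBounds (m dm lo hi : ℝ → ℝ → ℝ) (k : ℕ) (T : Set ℝ) (γ₀ ρ₀ : ℝ) : Prop where
  pos_of_mem : ∀ t ∈ T, 0 < t
  measurable : ∀ t, Measurable (m t)
  measurable_deriv : ∀ t, Measurable (dm t)
  measurable_lo : ∀ t, Measurable (lo t)
  measurable_hi : ∀ t, Measurable (hi t)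
  exists_bound : ∀ t, 0 < t → ∃ M, ∀ x, 0 < x → |m t x| ≤ M * besselSymbol γ₀ x
  exists_deriv_bound : ∀ δ, 0 < δ → ∃ M, ∀ t, δ ≤ t → ∀ x, 0 < x →
    |dm t x| ≤ M * besselSymbol γ₀ x
  deriv_eq : k = 0 ∧ dm = m ∨
    k = 1 ∧ ∀ t, 0 < t → ∀ x, 0 < x → HasDerivAt (fun t => m t x) (dm t x) t
  eq_add : ∀ t ∈ T, ∀ x, 0 < x → dm t x = lo t x + hi t x
  exists_lo_bound : ∃ M c : ℝ, 0 < M ∧ 0 < c ∧ ∀ t ∈ T, ∀ x, 0 < x →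
    |lo t x| ≤ M * (1 + t) ^ (-ρ₀) * Real.exp (-(c * (1 + t) * x))
  exists_hi_bound : ∃ M : ℝ, 0 < M ∧ ∀ t ∈ T, ∀ x, 0 < x →
    |hi t x| ≤ M * Real.exp (-(7 / 25 * t)) * besselSymbol γ₀ x

section Decay

open SpectralMeasure

variable {X 𝕜 : Type*} [RCLike 𝕜] [MeasurableSpace X] {μ : Measure X}
  {A : Lp 𝕜 2 μ →ₗ.[𝕜] Lp 𝕜 2 μ}

theorem abs_mul_bessel_neg_le {φ : ℝ → ℝ} {γ γ₀ M x : ℝ} (hM : |φ x| ≤ M * besselSymbol γ₀ x)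
    (hx : 0 < x) : |φ x * besselSymbol (-γ) x| ≤ M * besselSymbol (γ₀ - γ) x := by
  rw [abs_mul, abs_of_pos (besselSymbol_pos _ hx), sub_eq_add_neg, ← besselSymbol_mul _ _ hx,
    ← mul_assoc]
  exact mul_le_mul_of_nonneg_right hM (besselSymbol_pos _ hx).le

theorem abs_mul_bessel_neg_le_const {φ : ℝ → ℝ} {γ γ₀ M x : ℝ} (hγ : γ₀ ≤ γ)
    (hM : |φ x| ≤ M * besselSymbol γ₀ x) (hx : 0 < x) : |φ x * besselSymbol (-γ) x| ≤ M := by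
  refine (abs_mul_bessel_neg_le hM hx).trans (mul_le_of_le_one_right ?_
    (besselSymbol_le_one (by linarith) hx))
  have := (abs_nonneg _).trans hM
  exact nonneg_of_mul_nonneg_left this (besselSymbol_pos _ hx)

/-- The part common to both target norms: existence of `m(t, A) f`, its time derivative, and the
splitting into low and high frequencies. Only the mapping properties `hlo` and `hhi` depend on `p`.
-/
theorem SymbolBounds.decayEstimate {m dm lo hi : ℝ → ℝ → ℝ} {k : ℕ} {T : Set ℝ} {γ₀ ρ₀ : ℝ}
    (hS : SymbolBounds m dm lo hi k T γ₀ ρ₀) {α C : ℝ}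
    (hE : (spectralResolution A).IsPositive) (hH : (spectralResolution A).HeatBound α C)
    {γ : ℝ} (hγ : γ₀ ≤ γ) {p q : ℝ≥0∞} (hp : 1 ≤ p) {ρ : ℝ} (hρ : 0 ≤ ρ)
    (hlo : ∃ K : ℝ, 0 < K ∧ ∀ (f : X → 𝕜) (h u : Lp 𝕜 2 μ), MemLp f q μ →
      (spectralResolution A).Represents γ f h → ∀ t ∈ T,
      (spectralResolution A).HasIntegral (fun x => lo t x * besselSymbol (-γ) x) h u →
      eLpNorm u p μ ≤ ENNReal.ofReal (K * (1 + t) ^ (-ρ)) * eLpNorm f q μ)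
    (hhi : ∃ K : ℝ, 0 < K ∧ ∀ (h u : Lp 𝕜 2 μ), ∀ t ∈ T,
      (spectralResolution A).HasIntegral (fun x => hi t x * besselSymbol (-γ) x) h u →
      eLpNorm u p μ ≤ ENNReal.ofReal (K * Real.exp (-(7 / 25 * t))) * ‖h‖ₑ) :
    DecayEstimate A m k p q γ ρ T := by
  set E := spectralResolution A with hEdef
  obtain ⟨K₁, hK₁, hlo⟩ := hlo
  obtain ⟨K₂, hK₂, hhi⟩ := hhi
  -- `3/100 = 7/25 - 1/4`: the surplus over the required factor `e^{-t/4}` is exchanged for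
  -- polynomial decay.
  obtain ⟨K₃, hK₃, hexp⟩ := exists_exp_neg_le_rpow_neg (ε := 3 / 100) (by norm_num) hρ
  have hmγ := measurable_besselSymbol (-γ)
  refine ⟨K₁ + K₂ * K₃, by positivity, fun f hf hfin => ?_⟩
  obtain ⟨h, hle, hrep, hcalc⟩ := exists_represents hE hH γ hfin
  have hmbound : ∀ t, 0 < t → ∃ M, ∀ x, 0 < x → |m t x * besselSymbol (-γ) x| ≤ M := by
    intro t ht
    obtain ⟨M, hM⟩ := hS.exists_bound t ht
    exact ⟨M, fun x hx => abs_mul_bessel_neg_le_const hγ (hM x hx) hx⟩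
  set w : ℝ → Lp 𝕜 2 μ := fun t => E.fc (fun x => m t x * besselSymbol (-γ) x) h with hw
  have hwint : ∀ t, 0 < t → E.HasIntegral (fun x => m t x * besselSymbol (-γ) x) h (w t) := by
    intro t ht
    obtain ⟨M, hM⟩ := hmbound t ht
    exact hE.hasIntegral_fc ((hS.measurable t).mul hmγ) hM h
  set w' : ℝ → Lp 𝕜 2 μ := fun t => E.fc (fun x => dm t x * besselSymbol (-γ) x) h with hw'
  have hdbound : ∀ δ, 0 < δ → ∃ M, ∀ t, δ ≤ t → ∀ x, 0 < x →
      |dm t x * besselSymbol (-γ) x| ≤ M := by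
    intro δ hδ
    obtain ⟨M, hM⟩ := hS.exists_deriv_bound δ hδ
    exact ⟨M, fun t ht x hx => abs_mul_bessel_neg_le_const hγ (hM t ht x hx) hx⟩
  have hwint' : ∀ t, 0 < t → E.HasIntegral (fun x => dm t x * besselSymbol (-γ) x) h (w' t) := by
    intro t ht
    obtain ⟨M, hM⟩ := hdbound t ht
    exact hE.hasIntegral_fc ((hS.measurable_deriv t).mul hmγ) (hM t le_rfl) h
  refine ⟨w, fun t ht => hcalc (m t) (hS.measurable t) (hmbound t ht), fun t htT => ?_⟩
  have ht := hS.pos_of_mem t htT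
  have hderiv : (∀ j < k, DifferentiableAt ℝ (iteratedDeriv j w) t) ∧
      iteratedDeriv k w t = w' t := by
    rcases hS.deriv_eq with ⟨rfl, hdm⟩ | ⟨rfl, hdm⟩
    · refine ⟨fun j hj => absurd hj (Nat.not_lt_zero j), ?_⟩
      rw [iteratedDeriv_zero, hw, hw', hdm]
    -- The derivative bound is uniform away from `t = 0`, hence on the ball of radius `t/2` used for
    -- dominated convergence.
    · obtain ⟨M, hM⟩ := hdbound (t / 2) (by positivity)
      have hball : ∀ s ∈ Metric.ball t (t / 2), t / 2 ≤ s := by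
        intro s hs
        rw [Metric.mem_ball, Real.dist_eq, abs_lt] at hs
        linarith [hs.1]
      have hd : HasDerivAt w (w' t) t := by
        refine hE.hasDerivAt (φ := fun t x => m t x * besselSymbol (-γ) x)
          (φ' := fun t x => dm t x * besselSymbol (-γ) x) (half_pos ht)
          (fun s hs => hwint s ?_) (hwint' t ht) (fun s hs x hx => ?_)
          (fun s hs x hx => hM s (hball s hs) x hx)
        · linarith [hball s hs]
        · exact (hdm s (by linarith [hball s hs]) x hx).mul_const _
      refine ⟨fun j hj => ?_, ?_⟩
      · obtain rfl : j = 0 := by omega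
        rw [iteratedDeriv_zero]
        exact hd.differentiableAt
      · rw [iteratedDeriv_one, hd.deriv]
  refine ⟨hderiv.1, ?_⟩
  rw [hderiv.2]
  obtain ⟨M₁, c, hM₁, hc, hlob⟩ := hS.exists_lo_bound
  obtain ⟨M₂, hM₂, hhib⟩ := hS.exists_hi_bound
  have hhib' : ∀ x, 0 < x → |hi t x * besselSymbol (-γ) x| ≤ M₂ * Real.exp (-(7 / 25 * t)) :=
    fun x hx => abs_mul_bessel_neg_le_const hγ (hhib t htT x hx) hx
  have hHi := hE.hasIntegral_fc ((hS.measurable_hi t).mul hmγ) hhib' h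
  have hLo := hE.congr (ψ := fun x => lo t x * besselSymbol (-γ) x)
    ((hwint' t ht).add (hHi.const_mul (-1))) ((hS.measurable_lo t).mul hmγ) (fun x hx => by
      simp only [Pi.mul_apply]
      rw [hS.eq_add t htT x hx]; ring)
  set uhi := E.fc (fun x => hi t x * besselSymbol (-γ) x) h with huhi
  set ulo := w' t + ((-1 : ℝ) : 𝕜) • uhi with hulo
  have hsplit : w' t = ulo + uhi := by
    rw [hulo]; simp
  rw [hsplit]
  refine (eLpNorm_coe_add_le hp ulo uhi).trans ?_
  have hb1 := hlo f h ulo hf hrep t htT hLo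
  have hb2 := hhi h uhi t htT hHi
  have hJ := one_add_rpow_neg_le ht hρ
  have hJ0 : 0 ≤ japaneseBracket t ^ (-ρ) :=
    Real.rpow_nonneg (by linarith [one_le_japaneseBracket t]) _
  rw [mul_add]
  refine add_le_add (hb1.trans (mul_le_mul_left (ENNReal.ofReal_le_ofReal ?_) _))
    (hb2.trans ?_)
  · calc K₁ * (1 + t) ^ (-ρ) ≤ K₁ * japaneseBracket t ^ (-ρ) := by gcongr
      _ ≤ (K₁ + K₂ * K₃) * japaneseBracket t ^ (-ρ) := by
        gcongr
        linarith [mul_pos hK₂ hK₃]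
  · rw [← mul_assoc, ← ENNReal.ofReal_mul (by positivity)]
    refine mul_le_mul' (ENNReal.ofReal_le_ofReal ?_) hle
    have h1 : Real.exp (-(7 / 25 * t)) = Real.exp (-(3 / 100 * t)) * Real.exp (-t / 4) := by
      rw [← Real.exp_add]; congr 1; ring
    calc K₂ * Real.exp (-(7 / 25 * t)) = K₂ * Real.exp (-(3 / 100 * t)) * Real.exp (-t / 4) := by
          rw [h1]; ring
      _ ≤ K₂ * (K₃ * (1 + t) ^ (-ρ)) * Real.exp (-t / 4) := by
          gcongr; exact hexp t ht
      _ ≤ K₂ * (K₃ * japaneseBracket t ^ (-ρ)) * Real.exp (-t / 4) := by gcongr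
      _ = (K₂ * K₃) * japaneseBracket t ^ (-ρ) * Real.exp (-t / 4) := by ring
      _ ≤ (K₁ + K₂ * K₃) * japaneseBracket t ^ (-ρ) * Real.exp (-t / 4) := by
          gcongr; linarith

/-- The rate of the `L^q → L²` bound at time `c (1 + t)`. -/
theorem heat_rate {C c α t q : ℝ} (hC : 0 < C) (hc : 0 < c) (ht : 0 < t) :
    (C * (c * (1 + t)) ^ (-α)) ^ (2 / q - 1) =
      (C * c ^ (-α)) ^ (2 / q - 1) * (1 + t) ^ (-(2 * α * (1 / q - 1 / 2))) := by
  rw [Real.mul_rpow hc.le (by linarith), ← mul_assoc, Real.mul_rpow (by positivity) (by positivity),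
    ← Real.rpow_mul (by linarith)]
  congr 2
  ring

theorem HeatDecay.exists_heatBound {α : ℝ} (hA : HeatDecay A α) :
    ∃ C : ℝ, 0 < C ∧ (spectralResolution A).HeatBound α C := by
  obtain ⟨C, hC, hH⟩ := hA
  exact ⟨C, hC, fun t ht f u hu => by rw [Lp.enorm_def]; exact hH t ht f u hu⟩

/-- The low part is dominated by `(1 + t)^{-ρ₀}` times the heat operator at time `c (1 + t)`, whose
`L^q → L²` bound supplies the remaining rate. The high part is bounded on `h` because the order `γ₀`
is exactly compensated. -/
theorem SymbolBounds.decayEstimate_two {m dm lo hi : ℝ → ℝ → ℝ} {k : ℕ} {T : Set ℝ} {γ₀ ρ₀ : ℝ}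
    (hS : SymbolBounds m dm lo hi k T γ₀ ρ₀) (hρ₀ : 0 ≤ ρ₀) {α : ℝ} (hα : 0 < α)
    (hA : HeatDecay A α) {q : ℝ} (hq1 : 1 ≤ q) (hq2 : q ≤ 2) :
    DecayEstimate A m k 2 (ENNReal.ofReal q) γ₀ (2 * α * (1 / q - 1 / 2) + ρ₀) T := by
  obtain ⟨C, hC, hH⟩ := hA.exists_heatBound
  have hE := hH.isPositive hα
  have hq0 : 0 < q := by linarith
  have hq : 0 ≤ 2 * α * (1 / q - 1 / 2) := by
    have : 1 / 2 ≤ 1 / q := one_div_le_one_div_of_le hq0 hq2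
    exact mul_nonneg (by positivity) (by linarith)
  have hθ : 0 ≤ 2 / q - 1 := by rw [sub_nonneg, le_div_iff₀ hq0]; linarith
  refine hS.decayEstimate hE hH le_rfl (by norm_num) (by linarith) ?_ ?_
  · obtain ⟨M, c, hM, hc, hlo⟩ := hS.exists_lo_bound
    refine ⟨M * (C * c ^ (-α)) ^ (2 / q - 1), by positivity, fun f h u hf hrep t ht hu => ?_⟩
    have ht0 := hS.pos_of_mem t ht
    have hτ : 0 < c * (1 + t) := by positivity
    have hheat := hE.hasIntegral_exp_mul_bessel (-γ₀) hτ h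
    have h1 := hE.enorm_le hu hheat (M := M * (1 + t) ^ (-ρ₀)) (fun x hx => by
      rw [abs_mul, abs_mul, Real.abs_exp, ← mul_assoc]
      exact mul_le_mul_of_nonneg_right (hlo t ht x hx) (abs_nonneg _))
    have h2 := hrep.enorm_heat_le hE hH hq1 hq2 hf hτ
    rw [← Lp.enorm_def]
    refine (h1.trans (mul_le_mul_right h2 _)).trans_eq ?_
    rw [ENNReal.ofReal_rpow_of_nonneg (by positivity) hθ, ← mul_assoc,
      ← ENNReal.ofReal_mul (by positivity), heat_rate hC hc ht0]
    congr 2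
    rw [neg_add, Real.rpow_add (by linarith)]
    ring
  · obtain ⟨M, hM, hhi⟩ := hS.exists_hi_bound
    refine ⟨M, hM, fun h u t ht hu => ?_⟩
    rw [← Lp.enorm_def]
    exact hE.enorm_le hu (hasIntegral_one h) (fun x hx => by
      rw [abs_one, mul_one]
      exact abs_mul_bessel_neg_le_const le_rfl (hhi t ht x hx) hx)

/-- The time `c (1 + t)` of the dominating heat operator is halved, one half for `L^q → L²` and the
other for `L² → L^∞`, so the rates add up to `2α/q`. The high part uses the embedding with `σ = β -
γ₀ > 2α`. -/
theorem SymbolBounds.decayEstimate_top {m dm lo hi : ℝ → ℝ → ℝ} {k : ℕ} {T : Set ℝ} {γ₀ ρ₀ : ℝ}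
    (hS : SymbolBounds m dm lo hi k T γ₀ ρ₀) (hρ₀ : 0 ≤ ρ₀) {α : ℝ} (hα : 0 < α)
    (hA : HeatDecay A α) {q : ℝ} (hq1 : 1 ≤ q) (hq2 : q ≤ 2) {β : ℝ} (hβ : 2 * α + γ₀ < β) :
    DecayEstimate A m k ⊤ (ENNReal.ofReal q) β (2 * α / q + ρ₀) T := by
  obtain ⟨C, hC, hH⟩ := hA.exists_heatBound
  have hE := hH.isPositive hα
  have hq0 : 0 < q := by linarith
  have hθ : 0 ≤ 2 / q - 1 := by rw [sub_nonneg, le_div_iff₀ hq0]; linarith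
  refine hS.decayEstimate hE hH (by linarith) le_top (by positivity) ?_ ?_
  · obtain ⟨M, c, hM, hc, hlo⟩ := hS.exists_lo_bound
    have hc2 : 0 < c / 2 := by positivity
    refine ⟨M * (C * (c / 2) ^ (-α)) * (C * (c / 2) ^ (-α)) ^ (2 / q - 1), by positivity,
      fun f h u hf hrep t ht hu => ?_⟩
    have ht0 := hS.pos_of_mem t ht
    have hτ : 0 < c / 2 * (1 + t) := by positivity
    have hmβ := measurable_besselSymbol (-β)
    have hmlo := hS.measurable_lo t
    have hheat := hE.hasIntegral_exp_mul_bessel (-β) hτ h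
    have hexp : ∀ x, Real.exp (c / 2 * (1 + t) * x) * Real.exp (-(c * (1 + t) * x)) =
        Real.exp (-(c / 2 * (1 + t) * x)) := fun x => by
      rw [← Real.exp_add]; congr 1; ring
    have hb : ∀ x, 0 < x → |Real.exp (c / 2 * (1 + t) * x) * (lo t x * besselSymbol (-β) x)| ≤
        M * (1 + t) ^ (-ρ₀) * |Real.exp (-(c / 2 * (1 + t) * x)) * besselSymbol (-β) x| := by
      intro x hx
      rw [abs_mul, abs_mul, abs_mul, Real.abs_exp, Real.abs_exp, ← mul_assoc, ← mul_assoc]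
      refine mul_le_mul_of_nonneg_right ?_ (abs_nonneg _)
      calc Real.exp (c / 2 * (1 + t) * x) * |lo t x|
          ≤ Real.exp (c / 2 * (1 + t) * x) *
            (M * (1 + t) ^ (-ρ₀) * Real.exp (-(c * (1 + t) * x))) := by
            gcongr; exact hlo t ht x hx
        _ = M * (1 + t) ^ (-ρ₀) * Real.exp (-(c / 2 * (1 + t) * x)) := by
            rw [← hexp x]; ring
    obtain ⟨M', hM'⟩ := exists_exp_mul_besselSymbol_le (-β) hτ
    have hg := hE.hasIntegral_fc
      (φ := fun x => Real.exp (c / 2 * (1 + t) * x) * (lo t x * besselSymbol (-β) x))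
      (C := M * (1 + t) ^ (-ρ₀) * M') (by fun_prop)
      (fun x hx => (hb x hx).trans (by gcongr; exact hM' x hx)) h
    set g := (spectralResolution A).fc
      (fun x => Real.exp (c / 2 * (1 + t) * x) * (lo t x * besselSymbol (-β) x)) h
    have hcomp : (spectralResolution A).HasIntegral
        (fun x => Real.exp (-(c / 2 * (1 + t) * x))) g u := by
      refine hg.comp (by fun_prop) ?_
      convert hu using 2 with x
      rw [← mul_assoc, ← Real.exp_add]
      simp
    have h1 := hH _ hτ _ _ hcomp
    have h2 := hE.enorm_le hg hheat hb
    have h3 := hrep.enorm_heat_le hE hH hq1 hq2 hf hτ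
    refine (h1.trans (mul_le_mul_right (h2.trans (mul_le_mul_right h3 _)) _)).trans_eq ?_
    rw [ENNReal.ofReal_rpow_of_nonneg (by positivity) hθ, ← mul_assoc, ← mul_assoc,
      ← ENNReal.ofReal_mul (by positivity), ← ENNReal.ofReal_mul (by positivity),
      heat_rate hC hc2 ht0, Real.mul_rpow hc2.le (by linarith)]
    congr 2
    have hr : (1 + t) ^ (-(2 * α / q + ρ₀)) =
        (1 + t) ^ (-α) * (1 + t) ^ (-ρ₀) * (1 + t) ^ (-(2 * α * (1 / q - 1 / 2))) := by
      rw [← Real.rpow_add (by linarith), ← Real.rpow_add (by linarith)]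
      congr 1
      ring
    rw [hr]
    ring
  · obtain ⟨M, hM, hhi⟩ := hS.exists_hi_bound
    obtain ⟨K, hK, hemb⟩ := hH.exists_eLpNorm_top_le hC hE (σ := β - γ₀) (by linarith)
      (by linarith)
    refine ⟨K * M, by positivity, fun h u t ht hu => ?_⟩
    have := hemb _ h u (M * Real.exp (-(7 / 25 * t))) (by positivity) (fun x hx => by
      rw [neg_sub]
      exact abs_mul_bessel_neg_le (hhi t ht x hx) hx) hu
    rwa [← mul_assoc] at this

end Decay

/-! ### Pointwise analysis of the damped symbol -/

/-- The time derivative `∂_t 𝒟(t, λ)`. -/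
def dampedSymbolDeriv (t x : ℝ) : ℝ :=
  Real.exp (-t / 2) * (if x < 1 / 4 then Real.cosh (t * Real.sqrt (1 / 4 - x))
    else if x = 1 / 4 then 1 else Real.cos (t * Real.sqrt (x - 1 / 4))) - dampedSymbol t x / 2

theorem measurable_dampedSymbol (t : ℝ) : Measurable (dampedSymbol t) := by
  unfold dampedSymbol
  refine Measurable.ite measurableSet_Iio (by fun_prop)
    (Measurable.ite (measurableSet_singleton _) (by fun_prop) (by fun_prop))

theorem measurable_dampedSymbolDeriv (t : ℝ) : Measurable (dampedSymbolDeriv t) := by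
  unfold dampedSymbolDeriv
  refine Measurable.sub (Measurable.const_mul (Measurable.ite measurableSet_Iio (by fun_prop)
    (Measurable.ite (measurableSet_singleton _) (by fun_prop) (by fun_prop))) _)
    ((measurable_dampedSymbol t).div_const _)

theorem hasDerivAt_dampedSymbol (t x : ℝ) :
    HasDerivAt (fun t => dampedSymbol t x) (dampedSymbolDeriv t x) t := by
  have he : HasDerivAt (fun t : ℝ => Real.exp (-t / 2)) (Real.exp (-t / 2) * (-1 / 2)) t :=
    ((hasDerivAt_id t).neg.div_const 2).exp
  unfold dampedSymbolDeriv dampedSymbol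
  split_ifs with h1 h2
  · have hr : Real.sqrt (1 / 4 - x) ≠ 0 := (Real.sqrt_pos.2 (by linarith)).ne'
    have hs := ((hasDerivAt_id t).mul_const (Real.sqrt (1 / 4 - x))).sinh
    refine ((he.mul hs).div_const (Real.sqrt (1 / 4 - x))).congr_deriv ?_
    simp only [id_eq]
    generalize Real.sqrt (1 / 4 - x) = r at hr ⊢
    field_simp
    ring
  · refine ((hasDerivAt_id t).mul he).congr_deriv ?_
    simp only [id_eq]
    ring
  · have hr : Real.sqrt (x - 1 / 4) ≠ 0 :=
      (Real.sqrt_pos.2 (by have := lt_of_le_of_ne (not_lt.1 h1) (Ne.symm h2); linarith)).ne'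
    have hs := ((hasDerivAt_id t).mul_const (Real.sqrt (x - 1 / 4))).sin
    refine ((he.mul hs).div_const (Real.sqrt (x - 1 / 4))).congr_deriv ?_
    simp only [id_eq]
    generalize Real.sqrt (x - 1 / 4) = r at hr ⊢
    field_simp
    ring

/-- For small `λ`, in terms of the smaller root `p` of `p (1 - p) = λ`. -/
theorem exists_dampedSymbol_eq {x : ℝ} (hx : 0 < x) (hx' : x ≤ 21 / 100) :
    ∃ p : ℝ, 0 < p ∧ p ≤ 3 / 10 ∧ x = p * (1 - p) ∧
      (∀ t, dampedSymbol t x =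
        (Real.exp (-(t * p)) - Real.exp (-(t * (1 - p)))) / (1 - 2 * p)) ∧
      ∀ t, dampedSymbolDeriv t x =
        (-p * Real.exp (-(t * p)) + (1 - p) * Real.exp (-(t * (1 - p)))) / (1 - 2 * p) := by
  have hlt : x < 1 / 4 := by linarith
  set r := Real.sqrt (1 / 4 - x) with hr
  have hr2 : r ^ 2 = 1 / 4 - x := Real.sq_sqrt (by linarith)
  have hr0 : 0 ≤ r := Real.sqrt_nonneg _
  -- The cut `21/100 = (3/10)(7/10)` corresponds to `r = 1/5` and `p = 3/10`, which keeps `1 - 2p ≥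
  -- 2/5`.
  have hr1 : 1 / 5 ≤ r := by
    rw [hr]; exact Real.le_sqrt_of_sq_le (by norm_num; linarith)
  have hr3 : r < 1 / 2 := by nlinarith
  have h12 : 1 - 2 * (1 / 2 - r) = 2 * r := by ring
  have hE : ∀ t, Real.exp (-t / 2) * Real.exp (t * r) = Real.exp (-(t * (1 / 2 - r))) := by
    intro t; rw [← Real.exp_add]; congr 1; ring
  have hE' : ∀ t, Real.exp (-t / 2) * Real.exp (-(t * r)) =
      Real.exp (-(t * (1 - (1 / 2 - r)))) := by
    intro t; rw [← Real.exp_add]; congr 1; ring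
  have hD : ∀ t, dampedSymbol t x = (Real.exp (-(t * (1 / 2 - r))) -
      Real.exp (-(t * (1 - (1 / 2 - r))))) / (1 - 2 * (1 / 2 - r)) := by
    intro t
    rw [dampedSymbol, if_pos hlt, ← hr, Real.sinh_eq, h12, ← hE, ← hE']
    field_simp
  refine ⟨1 / 2 - r, by linarith, by linarith, by nlinarith, hD, fun t => ?_⟩
  rw [dampedSymbolDeriv, if_pos hlt, ← hr, Real.cosh_eq, hD, ← hE, ← hE', h12]
  field_simp
  ring

/-- The time derivative of order `k ∈ {0, 1}` of `𝒟(t, λ)`. -/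
def dampedDeriv (k : ℕ) : ℝ → ℝ → ℝ := if k = 0 then dampedSymbol else dampedSymbolDeriv

/-- The time derivative of order `k` of `e^{-tλ}`. -/
def heatDeriv (k : ℕ) (t x : ℝ) : ℝ := (-x) ^ k * Real.exp (-(t * x))

theorem measurable_dampedDeriv (k : ℕ) (t : ℝ) : Measurable (dampedDeriv k t) := by
  unfold dampedDeriv
  split_ifs
  · exact measurable_dampedSymbol t
  · exact measurable_dampedSymbolDeriv t

theorem measurable_heatDeriv (k : ℕ) (t : ℝ) : Measurable (heatDeriv k t) := by
  unfold heatDeriv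
  fun_prop

/-- From `p ≥ x` and `1 - p ≥ 1/2` the exponentials are at most `e^{-tx}` and `e^{-t/2}`, and a time
derivative brings down `p ≤ 2x`. The term `t x^{k+1}` only matches the shape of the difference
bound, so that `exists_low_bound` serves both; the constants are generous. -/
theorem abs_dampedDeriv_le_of_le {k : ℕ} (hk : k = 0 ∨ k = 1) {t x : ℝ} (ht : 0 < t) (hx : 0 < x)
    (hx' : x ≤ 21 / 100) :
    |dampedDeriv k t x| ≤ 30 * (x ^ k + t * x ^ (k + 1)) * Real.exp (-(t * x)) +
      30 * Real.exp (-(t / 2)) := by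
  obtain ⟨p, hp0, hp1, hxp, hD, hD'⟩ := exists_dampedSymbol_eq hx hx'
  have hpx : p ≤ 2 * x := by nlinarith
  have hxp' : x ≤ p := by nlinarith
  have h1 : Real.exp (-(t * p)) ≤ Real.exp (-(t * x)) := Real.exp_le_exp.2 (by nlinarith)
  have h2 : Real.exp (-(t * (1 - p))) ≤ Real.exp (-(t / 2)) := Real.exp_le_exp.2 (by nlinarith)
  have e1 := Real.exp_pos (-(t * p))
  have e2 := Real.exp_pos (-(t * (1 - p)))
  have hden : 2 / 5 ≤ 1 - 2 * p := by linarith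
  have e3 := Real.exp_pos (-(t * x))
  have e4 := Real.exp_pos (-(t / 2))
  have htx : 0 < t * x := by positivity
  rcases hk with rfl | rfl
  · rw [dampedDeriv, if_pos rfl, hD, abs_div, abs_of_pos (by linarith : 0 < 1 - 2 * p),
      div_le_iff₀ (by linarith)]
    have h3 : |Real.exp (-(t * p)) - Real.exp (-(t * (1 - p)))| ≤
        Real.exp (-(t * x)) + Real.exp (-(t / 2)) := by
      rw [abs_le]; constructor <;> linarith
    refine h3.trans ?_
    have h4 : Real.exp (-(t * x)) + Real.exp (-(t / 2)) ≤
        (30 * Real.exp (-(t * x)) + 30 * Real.exp (-(t / 2))) * (2 / 5) := by linarith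
    refine h4.trans (mul_le_mul ?_ hden (by norm_num) (by positivity))
    simp only [pow_zero, zero_add, pow_one]
    nlinarith [mul_pos htx e3]
  · rw [dampedDeriv, if_neg one_ne_zero, hD', abs_div, abs_of_pos (by linarith : 0 < 1 - 2 * p),
      div_le_iff₀ (by linarith)]
    have h3 : |-p * Real.exp (-(t * p)) + (1 - p) * Real.exp (-(t * (1 - p)))| ≤
        2 * x * Real.exp (-(t * x)) + Real.exp (-(t / 2)) := by
      have a1 : p * Real.exp (-(t * p)) ≤ 2 * x * Real.exp (-(t * x)) :=
        mul_le_mul hpx h1 e1.le (by positivity)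
      have a2 : (1 - p) * Real.exp (-(t * (1 - p))) ≤ 1 * Real.exp (-(t / 2)) :=
        mul_le_mul (by linarith) h2 e2.le (by norm_num)
      have a3 : 0 < p * Real.exp (-(t * p)) := by positivity
      have a4 : 0 ≤ (1 - p) * Real.exp (-(t * (1 - p))) := mul_nonneg (by linarith) e2.le
      rw [abs_le]; constructor <;> linarith
    refine h3.trans ?_
    have h5 : 0 < x * Real.exp (-(t * x)) := by positivity
    have h4 : 2 * x * Real.exp (-(t * x)) + Real.exp (-(t / 2)) ≤
        (30 * x * Real.exp (-(t * x)) + 30 * Real.exp (-(t / 2))) * (2 / 5) := by linarith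
    refine h4.trans (mul_le_mul ?_ hden (by norm_num) (by positivity))
    have h6 : 0 ≤ t * x ^ 2 * Real.exp (-(t * x)) := by positivity
    norm_num
    linarith

/-- Both discrepancies between the slow mode and the heat symbol are of relative order `x`: the
prefactor differs from its limit by `O(p)`, and the exponents differ by `t (p - x) = t p²`, whence
the term `t x^{k+2}`. -/
theorem abs_dampedDeriv_sub_heatDeriv_le {k : ℕ} (hk : k = 0 ∨ k = 1) {t x : ℝ} (ht : 0 < t)
    (hx : 0 < x) (hx' : x ≤ 21 / 100) :
    |dampedDeriv k t x - heatDeriv k t x| ≤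
      30 * (x ^ (k + 1) + t * x ^ (k + 1 + 1)) * Real.exp (-(t * x)) +
        30 * Real.exp (-(t / 2)) := by
  obtain ⟨p, hp0, hp1, hxp, hD, hD'⟩ := exists_dampedSymbol_eq hx hx'
  have hpx : p ≤ 2 * x := by nlinarith
  have hxp' : x ≤ p := by nlinarith
  have h1 : Real.exp (-(t * p)) ≤ Real.exp (-(t * x)) := Real.exp_le_exp.2 (by nlinarith)
  have h2 : Real.exp (-(t * (1 - p))) ≤ Real.exp (-(t / 2)) := Real.exp_le_exp.2 (by nlinarith)
  have e1 := Real.exp_pos (-(t * p))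
  have e2 := Real.exp_pos (-(t * (1 - p)))
  have hden : 2 / 5 ≤ 1 - 2 * p := by linarith
  have hinv1 : (1 - 2 * p)⁻¹ * (1 - 2 * p) = 1 := inv_mul_cancel₀ (by linarith)
  have e3 := Real.exp_pos (-(t * x))
  have e4 := Real.exp_pos (-(t / 2))
  have hinv : (1 - 2 * p)⁻¹ ≤ 5 / 2 := by
    rw [inv_le_comm₀ (by linarith) (by norm_num)]; norm_num; linarith
  have hinv0 : 0 < (1 - 2 * p)⁻¹ := inv_pos.2 (by linarith)
  have hpp : p ^ 2 ≤ 4 * x ^ 2 := by nlinarith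
  -- `e^{-tx} - e^{-tp} ≤ t (p - x) e^{-tx}` and `p - x = p²`
  have hdiff : Real.exp (-(t * x)) - Real.exp (-(t * p)) ≤ 4 * t * x ^ 2 * Real.exp (-(t * x)) := by
    have h3 : Real.exp (-(t * p)) = Real.exp (-(t * x)) * Real.exp (-(t * p ^ 2)) := by
      rw [← Real.exp_add]; congr 1; rw [hxp]; ring
    have h4 := Real.add_one_le_exp (-(t * p ^ 2))
    have h5 : t * p ^ 2 ≤ 4 * t * x ^ 2 := by nlinarith
    rw [h3]
    nlinarith
  have hdiff0 : 0 ≤ Real.exp (-(t * x)) - Real.exp (-(t * p)) := by linarith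
  rcases hk with rfl | rfl
  · have hid : dampedDeriv 0 t x - heatDeriv 0 t x =
        2 * p * (1 - 2 * p)⁻¹ * Real.exp (-(t * p)) -
          (Real.exp (-(t * x)) - Real.exp (-(t * p))) -
          (1 - 2 * p)⁻¹ * Real.exp (-(t * (1 - p))) := by
      rw [dampedDeriv, if_pos rfl, hD, heatDeriv, div_eq_mul_inv]
      linear_combination Real.exp (-(t * p)) * hinv1
    rw [hid]
    have a1 : 2 * p * (1 - 2 * p)⁻¹ * Real.exp (-(t * p)) ≤ 10 * x * Real.exp (-(t * x)) := by
      refine mul_le_mul ?_ h1 e1.le (by positivity)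
      nlinarith
    have a1' : 0 < 2 * p * (1 - 2 * p)⁻¹ * Real.exp (-(t * p)) := by positivity
    have a2 : (1 - 2 * p)⁻¹ * Real.exp (-(t * (1 - p))) ≤ 5 / 2 * Real.exp (-(t / 2)) :=
      mul_le_mul hinv h2 e2.le (by norm_num)
    have a2' : 0 < (1 - 2 * p)⁻¹ * Real.exp (-(t * (1 - p))) := by positivity
    have b1 : 0 < x * Real.exp (-(t * x)) := by positivity
    have b2 : 0 < t * x ^ 2 * Real.exp (-(t * x)) := by positivity
    norm_num
    rw [abs_le]; constructor <;> linarith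
  · have hid : dampedDeriv 1 t x - heatDeriv 1 t x =
        -- The coefficient of `e^{-tp}` follows from `p/(1 - 2p) - p (1 - p) = p² (3 - 2p)/(1 -
        -- 2p)`.
        x * (Real.exp (-(t * x)) - Real.exp (-(t * p))) -
          p ^ 2 * (3 - 2 * p) * (1 - 2 * p)⁻¹ * Real.exp (-(t * p)) +
          (1 - p) * (1 - 2 * p)⁻¹ * Real.exp (-(t * (1 - p))) := by
      rw [dampedDeriv, if_neg one_ne_zero, hD', heatDeriv, div_eq_mul_inv]
      linear_combination (-(Real.exp (-(t * p)) * p * (1 - p))) * hinv1 + Real.exp (-(t * p)) * hxp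
    rw [hid]
    have a0 : x * (Real.exp (-(t * x)) - Real.exp (-(t * p))) ≤
        4 * t * x ^ 3 * Real.exp (-(t * x)) := by
      calc _ ≤ x * (4 * t * x ^ 2 * Real.exp (-(t * x))) := by gcongr
        _ = _ := by ring
    have a0' : 0 ≤ x * (Real.exp (-(t * x)) - Real.exp (-(t * p))) := mul_nonneg hx.le hdiff0
    have a1 : p ^ 2 * (3 - 2 * p) * (1 - 2 * p)⁻¹ * Real.exp (-(t * p)) ≤
        4 * x ^ 2 * 3 * (5 / 2) * Real.exp (-(t * x)) := by
      gcongr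
      · linarith
      · linarith
    have a1' : 0 ≤ p ^ 2 * (3 - 2 * p) * (1 - 2 * p)⁻¹ * Real.exp (-(t * p)) := by
      have : 0 < 3 - 2 * p := by linarith
      positivity
    have a2 : (1 - p) * (1 - 2 * p)⁻¹ * Real.exp (-(t * (1 - p))) ≤
        1 * (5 / 2) * Real.exp (-(t / 2)) := by
      gcongr
      linarith
    have a2' : 0 ≤ (1 - p) * (1 - 2 * p)⁻¹ * Real.exp (-(t * (1 - p))) := by
      have : 0 < 1 - p := by linarith
      positivity
    have b1 : 0 < x ^ 2 * Real.exp (-(t * x)) := by positivity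
    have b2 : 0 < t * x ^ 3 * Real.exp (-(t * x)) := by positivity
    norm_num
    rw [abs_le]; constructor <;> linarith

theorem besselSymbol_neg_one {x : ℝ} (hx : 0 < x) :
    besselSymbol (-1) x = (Real.sqrt (1 + x))⁻¹ := by
  rw [besselSymbol, Real.sqrt_eq_rpow, ← Real.rpow_neg (by linarith)]
  norm_num

theorem sinh_le_mul_exp {z : ℝ} : Real.sinh z ≤ z * Real.exp z := by
  have h1 := Real.add_one_le_exp (-(2 * z))
  have h2 : Real.exp (-z) = Real.exp z * Real.exp (-(2 * z)) := by
    rw [← Real.exp_add]; congr 1; ring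
  rw [Real.sinh_eq, h2]
  nlinarith [Real.exp_pos z]

/-- Below `1/4` the square root is at most `1/5`, so the growth of `sinh` leaves `e^{-t/2 + t/5} =
e^{-3t/10}`. The removable singularity at `1/4` costs a factor `t`, through `sinh z ≤ z e^z` and
`|sin z| ≤ z`. -/
theorem abs_dampedSymbol_le_of_lt {t x : ℝ} (ht : 0 < t) (hx : 21 / 100 < x) :
    |dampedSymbol t x| ≤ (1 + 5 / 4 * t) * Real.exp (-(3 / 10 * t)) * besselSymbol (-1) x := by
  have hx0 : 0 < x := by linarith
  have hs : 0 < Real.sqrt (1 + x) := Real.sqrt_pos.2 (by linarith)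
  rw [besselSymbol_neg_one hx0, ← div_eq_mul_inv, le_div_iff₀ hs]
  have hs1 : x ≤ 1 / 4 → Real.sqrt (1 + x) ≤ 5 / 4 := fun h => by
    rw [Real.sqrt_le_left (by norm_num)]; norm_num; linarith
  have hexp : Real.exp (-t / 2) ≤ Real.exp (-(3 / 10 * t)) := Real.exp_le_exp.2 (by linarith)
  unfold dampedSymbol
  split_ifs with h1 h2
  · set r := Real.sqrt (1 / 4 - x) with hr
    have hr0 : 0 < r := Real.sqrt_pos.2 (by linarith)
    have hr1 : r ≤ 1 / 5 := by
      rw [hr, Real.sqrt_le_left (by norm_num)]; norm_num; linarith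
    have hsinh : 0 ≤ Real.sinh (t * r) := Real.sinh_nonneg_iff.2 (by positivity)
    rw [abs_of_nonneg (by positivity)]
    have h3 : Real.exp (-t / 2) * Real.sinh (t * r) / r ≤ t * Real.exp (-(3 / 10 * t)) := by
      rw [div_le_iff₀ hr0]
      calc Real.exp (-t / 2) * Real.sinh (t * r)
          ≤ Real.exp (-t / 2) * (t * r * Real.exp (t * r)) := by gcongr; exact sinh_le_mul_exp
        _ ≤ Real.exp (-t / 2) * (t * r * Real.exp (t * (1 / 5))) := by gcongr
        _ = t * (Real.exp (-t / 2) * Real.exp (t * (1 / 5))) * r := by ring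
        _ = t * Real.exp (-(3 / 10 * t)) * r := by
          rw [← Real.exp_add]; congr 3; ring
    calc _ ≤ t * Real.exp (-(3 / 10 * t)) * (5 / 4) := by
          gcongr; exact hs1 h1.le
      _ ≤ _ := by nlinarith [Real.exp_pos (-(3 / 10 * t))]
  · rw [abs_of_pos (by positivity)]
    calc t * Real.exp (-t / 2) * Real.sqrt (1 + x) ≤ t * Real.exp (-(3 / 10 * t)) * (5 / 4) := by
          gcongr; exact hs1 h2.le
      _ ≤ _ := by nlinarith [Real.exp_pos (-(3 / 10 * t))]
  · have hx4 : 1 / 4 < x := lt_of_le_of_ne (not_lt.1 h1) (Ne.symm h2)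
    set y := Real.sqrt (x - 1 / 4) with hy
    have hy0 : 0 < y := Real.sqrt_pos.2 (by linarith)
    have hy2 : y ^ 2 = x - 1 / 4 := Real.sq_sqrt (by linarith)
    -- The summand `y` cancels the denominator with `|sin| ≤ 1`; the summand `5/4` is handled by
    -- `|sin(ty)| ≤ ty`.
    have hs2 : Real.sqrt (1 + x) ≤ y + 5 / 4 := by
      rw [Real.sqrt_le_left (by linarith)]; nlinarith
    have hsin1 : |Real.sin (t * y)| ≤ 1 := Real.abs_sin_le_one _
    have hsin2 : |Real.sin (t * y)| ≤ t * y := by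
      have := Real.abs_sin_le_abs (x := t * y)
      rwa [abs_of_pos (by positivity : 0 < t * y)] at this
    rw [abs_div, abs_mul, Real.abs_exp, abs_of_pos hy0, div_mul_eq_mul_div, div_le_iff₀ hy0]
    calc Real.exp (-t / 2) * |Real.sin (t * y)| * Real.sqrt (1 + x)
        ≤ Real.exp (-(3 / 10 * t)) * |Real.sin (t * y)| * (y + 5 / 4) := by gcongr
      _ = Real.exp (-(3 / 10 * t)) * (|Real.sin (t * y)| * y + 5 / 4 * |Real.sin (t * y)|) := by ring
      _ ≤ Real.exp (-(3 / 10 * t)) * (1 * y + 5 / 4 * (t * y)) := by gcongr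
      _ = _ := by ring

theorem abs_dampedDeriv_le_of_lt {k : ℕ} (hk : k = 0 ∨ k = 1) {t x : ℝ} (ht : 0 < t)
    (hx : 21 / 100 < x) :
    |dampedDeriv k t x| ≤ 100 * Real.exp (-(7 / 25 * t)) * besselSymbol (k - 1) x := by
  have hx0 : 0 < x := by linarith
  have hD := abs_dampedSymbol_le_of_lt ht hx
  -- The linear factor is absorbed by `e^{t/50}`, with `1/50 = 3/10 - 7/25`; the constant satisfies
  -- `63/50 ≥ 5/4`.
  have hexp : (1 + 5 / 4 * t) * Real.exp (-(3 / 10 * t)) ≤ 63 * Real.exp (-(7 / 25 * t)) := by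
    have h1 : Real.exp (-(7 / 25 * t)) = Real.exp (1 / 50 * t) * Real.exp (-(3 / 10 * t)) := by
      rw [← Real.exp_add]; congr 1; ring
    rw [h1, ← mul_assoc]
    gcongr
    linarith [Real.add_one_le_exp (1 / 50 * t)]
  have hb := besselSymbol_pos (-1) hx0
  have hD' : |dampedSymbol t x| ≤ 63 * Real.exp (-(7 / 25 * t)) * besselSymbol (-1) x :=
    hD.trans (by gcongr)
  have he := Real.exp_pos (-(7 / 25 * t))
  rcases hk with rfl | rfl
  · rw [dampedDeriv, if_pos rfl]
    norm_num
    nlinarith [mul_pos he hb]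
  · rw [dampedDeriv, if_neg one_ne_zero]
    norm_num [besselSymbol_zero]
    have hb1 : besselSymbol (-1) x ≤ 1 := besselSymbol_le_one (by norm_num) hx0
    have hD1 : |dampedSymbol t x| ≤ 63 * Real.exp (-(7 / 25 * t)) := by nlinarith
    have hc : |Real.exp (-t / 2) * (if x < 1 / 4 then Real.cosh (t * Real.sqrt (1 / 4 - x))
        else if x = 1 / 4 then 1 else Real.cos (t * Real.sqrt (x - 1 / 4)))| ≤
        Real.exp (-(7 / 25 * t)) := by
      rw [abs_mul, Real.abs_exp]
      have h7 : Real.exp (-t / 2) * 1 ≤ Real.exp (-(7 / 25 * t)) := by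
        rw [mul_one]; exact Real.exp_le_exp.2 (by linarith)
      split_ifs with h1 h2
      · have hr1 : Real.sqrt (1 / 4 - x) ≤ 1 / 5 := by
          rw [Real.sqrt_le_left (by norm_num)]; norm_num; linarith
        have hr0 := Real.sqrt_nonneg (1 / 4 - x)
        rw [abs_of_pos (Real.cosh_pos _)]
        have h3 : Real.cosh (t * Real.sqrt (1 / 4 - x)) ≤ Real.exp (t * (1 / 5)) := by
          have h4 : Real.exp (-(t * Real.sqrt (1 / 4 - x))) ≤ Real.exp (t * (1 / 5)) :=
            Real.exp_le_exp.2 (by nlinarith [mul_nonneg ht.le hr0])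
          have h5 : Real.exp (t * Real.sqrt (1 / 4 - x)) ≤ Real.exp (t * (1 / 5)) :=
            Real.exp_le_exp.2 (by nlinarith)
          rw [Real.cosh_eq]
          linarith
        calc _ ≤ Real.exp (-t / 2) * Real.exp (t * (1 / 5)) := by gcongr
          _ = Real.exp (-(3 / 10 * t)) := by rw [← Real.exp_add]; congr 1; ring
          _ ≤ _ := Real.exp_le_exp.2 (by linarith)
      · simpa using h7
      · refine le_trans ?_ h7
        gcongr
        exact Real.abs_cos_le_one _
    unfold dampedSymbolDeriv
    refine (abs_sub _ _).trans ?_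
    rw [abs_div, abs_two]
    linarith

/-! ### Symbol bounds for the solution and the difference -/

theorem exists_rpow_le_mul_rpow_neg_mul_exp {p ε : ℝ} (hp : 0 ≤ p) (hε : 0 < ε) :
    ∃ C : ℝ, 0 < C ∧ ∀ τ x : ℝ, 0 < τ → 0 < x →
      x ^ p ≤ C * τ ^ (-p) * Real.exp (ε * (τ * x)) := by
  obtain ⟨C, hC, h⟩ := Real.exists_rpow_le_mul_exp p hε hp
  refine ⟨C, hC, fun τ x hτ hx => ?_⟩
  have h1 := h (τ * x) (by positivity)
  rw [Real.mul_rpow hτ.le hx.le] at h1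
  have h2 : τ ^ (-p) * τ ^ p = 1 := by rw [← Real.rpow_add hτ, neg_add_cancel, Real.rpow_zero]
  calc x ^ p = τ ^ (-p) * (τ ^ p * x ^ p) := by rw [← mul_assoc, h2, one_mul]
    _ ≤ τ ^ (-p) * (C * Real.exp (ε * (τ * x))) := by gcongr
    _ = _ := by ring

theorem exp_neg_mul_le {t x : ℝ} (hx : x ≤ 1) :
    Real.exp (-(t * x)) ≤ Real.exp 1 * Real.exp (-((1 + t) * x)) := by
  rw [← Real.exp_add]
  exact Real.exp_le_exp.2 (by nlinarith)

/-- Pointwise bounds near the bottom of the spectrum are controlled by the heat semigroup. -/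
theorem exists_low_bound (j : ℕ) {s : ℝ} (hs : 0 ≤ s) :
    ∃ C : ℝ, 0 < C ∧ ∀ t x z : ℝ, 0 < t → 0 < x → x ≤ 21 / 100 →
      |z| ≤ 30 * (x ^ j + t * x ^ (j + 1)) * Real.exp (-(t * x)) + 30 * Real.exp (-(t / 2)) →
      |x ^ (s / 2) * z| ≤ C * (1 + t) ^ (-(j + s / 2)) * Real.exp (-(1 / 4 * (1 + t) * x)) := by
  set P : ℝ := j + s / 2 with hP
  have hP0 : 0 ≤ P := by positivity
  -- Three quarters of the exponent in `e^{-(1+t)x}` absorb the powers of `x`; the remaining quarter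
  -- is the heat factor in the conclusion.
  obtain ⟨C₁, hC₁, h₁⟩ := exists_rpow_le_mul_rpow_neg_mul_exp hP0 (ε := 3 / 4) (by norm_num)
  obtain ⟨C₂, hC₂, h₂⟩ := exists_rpow_le_mul_rpow_neg_mul_exp (p := P + 1) (by linarith)
    (ε := 3 / 4) (by norm_num)
  obtain ⟨C₃, hC₃, h₃⟩ := exists_exp_neg_le_rpow_neg (ε := 1 / 4) (by norm_num) hP0
  refine ⟨30 * Real.exp 1 * (C₁ + C₂ + C₃), by positivity, fun t x z ht hx hx1 hz => ?_⟩
  have hτ : 0 < 1 + t := by linarith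
  have hxs : 0 ≤ x ^ (s / 2) := by positivity
  have hxs1 : x ^ (s / 2) ≤ 1 := Real.rpow_le_one hx.le (by linarith) (by linarith)
  have hxP : x ^ (s / 2) * x ^ j = x ^ P := by
    rw [hP, add_comm, Real.rpow_add hx, Real.rpow_natCast]
  have hxP1 : x ^ (s / 2) * x ^ (j + 1) = x ^ (P + 1) := by
    rw [Real.rpow_add hx, ← hxP, Real.rpow_one, pow_succ]; ring
  have hτP : (1 + t) ^ (-(P + 1)) * (1 + t) = (1 + t) ^ (-P) := by
    conv_lhs => rw [← Real.rpow_one (1 + t), ← Real.rpow_mul hτ.le, one_mul,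
      ← Real.rpow_add hτ]
    congr 1; ring
  set R := (1 + t) ^ (-P) with hR
  have hR0 : 0 < R := by positivity
  set G := Real.exp (-(1 / 4 * (1 + t) * x)) with hG
  have hG0 : 0 < G := Real.exp_pos _
  have hexp : Real.exp (3 / 4 * ((1 + t) * x)) * Real.exp (-((1 + t) * x)) = G := by
    rw [hG, ← Real.exp_add]; congr 1; ring
  have b1 : x ^ P * Real.exp (-(t * x)) ≤ C₁ * R * (Real.exp 1 * G) := by
    calc _ ≤ (C₁ * R * Real.exp (3 / 4 * ((1 + t) * x))) *
          (Real.exp 1 * Real.exp (-((1 + t) * x))) :=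
          mul_le_mul (h₁ _ x hτ hx) (exp_neg_mul_le (by linarith)) (Real.exp_pos _).le
            (by positivity)
      _ = C₁ * R * (Real.exp 1 *
          (Real.exp (3 / 4 * ((1 + t) * x)) * Real.exp (-((1 + t) * x)))) := by ring
      _ = _ := by rw [hexp]
  have b2 : t * x ^ (P + 1) * Real.exp (-(t * x)) ≤ C₂ * R * (Real.exp 1 * G) := by
    calc _ ≤ ((1 + t) * (C₂ * (1 + t) ^ (-(P + 1)) * Real.exp (3 / 4 * ((1 + t) * x)))) *
          (Real.exp 1 * Real.exp (-((1 + t) * x))) :=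
          mul_le_mul (mul_le_mul (by linarith) (h₂ _ x hτ hx) (by positivity) hτ.le)
            (exp_neg_mul_le (by linarith)) (Real.exp_pos _).le (by positivity)
      _ = C₂ * ((1 + t) ^ (-(P + 1)) * (1 + t)) * (Real.exp 1 *
          (Real.exp (3 / 4 * ((1 + t) * x)) * Real.exp (-((1 + t) * x)))) := by ring
      _ = _ := by rw [hexp, hτP]
  have b3 : x ^ (s / 2) * Real.exp (-(t / 2)) ≤ C₃ * R * (Real.exp 1 * G) := by
    -- One half of `e^{-t/2}` supplies polynomial decay; the other is below the heat factor up to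
    -- `e`, since `x` is bounded by 1.
    have c1 : Real.exp (-(t / 2)) = Real.exp (-(1 / 4 * t)) * Real.exp (-(1 / 4 * t)) := by
      rw [← Real.exp_add]; congr 1; ring
    have c2 : Real.exp (-(1 / 4 * t)) ≤ Real.exp 1 * G := by
      rw [hG, ← Real.exp_add]
      exact Real.exp_le_exp.2 (by nlinarith)
    calc _ ≤ 1 * Real.exp (-(t / 2)) := by gcongr
      _ = Real.exp (-(1 / 4 * t)) * Real.exp (-(1 / 4 * t)) := by rw [one_mul, c1]
      _ ≤ _ := mul_le_mul (h₃ t ht) c2 (Real.exp_pos _).le (by positivity)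
  rw [abs_mul, abs_of_nonneg hxs]
  calc x ^ (s / 2) * |z|
      ≤ x ^ (s / 2) * (30 * (x ^ j + t * x ^ (j + 1)) * Real.exp (-(t * x)) +
        30 * Real.exp (-(t / 2))) := by gcongr
    _ = 30 * ((x ^ (s / 2) * x ^ j) * Real.exp (-(t * x))) +
        30 * (t * (x ^ (s / 2) * x ^ (j + 1)) * Real.exp (-(t * x))) +
        30 * (x ^ (s / 2) * Real.exp (-(t / 2))) := by ring
    _ = 30 * (x ^ P * Real.exp (-(t * x))) + 30 * (t * x ^ (P + 1) * Real.exp (-(t * x))) +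
        30 * (x ^ (s / 2) * Real.exp (-(t / 2))) := by rw [hxP, hxP1]
    _ ≤ 30 * (C₁ * R * (Real.exp 1 * G)) + 30 * (C₂ * R * (Real.exp 1 * G)) +
        30 * (C₃ * R * (Real.exp 1 * G)) := by linarith
    _ = _ := by ring

theorem rpow_le_besselSymbol {s x : ℝ} (hs : 0 ≤ s) (hx : 0 < x) :
    x ^ (s / 2) ≤ besselSymbol s x :=
  Real.rpow_le_rpow hx.le (by linarith) (by linarith)

theorem abs_rpow_mul_le_besselSymbol {s γ M x z : ℝ} (hs : 0 ≤ s) (hx : 0 < x)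
    (hz : |z| ≤ M * besselSymbol γ x) : |x ^ (s / 2) * z| ≤ M * besselSymbol (γ + s) x := by
  rw [abs_mul, abs_of_nonneg (by positivity)]
  calc x ^ (s / 2) * |z| ≤ besselSymbol s x * (M * besselSymbol γ x) :=
        mul_le_mul (rpow_le_besselSymbol hs hx) hz (abs_nonneg _) (besselSymbol_pos _ hx).le
    _ = M * besselSymbol (γ + s) x := by rw [← besselSymbol_mul γ s hx]; ring

theorem exists_abs_dampedDeriv_le {k : ℕ} (hk : k = 0 ∨ k = 1) :
    ∃ M : ℝ, ∀ t x : ℝ, 0 < t → 0 < x → |dampedDeriv k t x| ≤ M * besselSymbol (k - 1) x := by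
  obtain ⟨C, hC, h⟩ := exists_low_bound k (s := 0) le_rfl
  refine ⟨2 * C + 100, fun t x ht hx => ?_⟩
  have hb := besselSymbol_pos ((k : ℝ) - 1) hx
  rcases le_or_gt x (21 / 100) with hx1 | hx1
  · have h1 := h t x _ ht hx hx1 (abs_dampedDeriv_le_of_le hk ht hx hx1)
    rw [zero_div, Real.rpow_zero, one_mul] at h1
    have h2 : (1 + t) ^ (-((k : ℝ) + 0)) ≤ 1 :=
      Real.rpow_le_one_of_one_le_of_nonpos (by linarith) (by simp)
    have h3 : Real.exp (-(1 / 4 * (1 + t) * x)) ≤ 1 := Real.exp_le_one_iff.2 (by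
      rw [neg_nonpos]; positivity)
    have h4 : |dampedDeriv k t x| ≤ C := by
      refine h1.trans ?_
      calc _ ≤ C * 1 * 1 := by gcongr
        _ = C := by ring
    have h5 : 1 / 2 ≤ besselSymbol (k - 1) x := by
      refine le_trans ?_ (besselSymbol_mono (r := -1) (by simp) hx)
      rw [besselSymbol_neg_one hx, one_div]
      refine inv_anti₀ (Real.sqrt_pos.2 (by linarith)) ?_
      rw [Real.sqrt_le_left (by norm_num)]
      linarith
    nlinarith
  · refine (abs_dampedDeriv_le_of_lt hk ht hx1).trans ?_
    have : Real.exp (-(7 / 25 * t)) ≤ 1 := Real.exp_le_one_iff.2 (by linarith)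
    gcongr
    linarith

/-- For `t ≥ δ` the exponential absorbs any power of `1 + x`, so the heat symbol obeys the same
order bound as the damped one. -/
theorem exists_abs_heatDeriv_le (k : ℕ) {δ : ℝ} (hδ : 0 < δ) :
    ∃ M : ℝ, ∀ t x : ℝ, δ ≤ t → 0 < x → |heatDeriv k t x| ≤ M * besselSymbol (k - 1) x := by
  obtain ⟨M, hM⟩ := exists_exp_mul_besselSymbol_le (k + 1) hδ
  refine ⟨M, fun t x ht hx => ?_⟩
  have h1 : |heatDeriv k t x| ≤ Real.exp (-(δ * x)) * besselSymbol (2 * k) x := by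
    rw [heatDeriv, abs_mul, abs_pow, abs_neg, abs_of_pos hx, Real.abs_exp, mul_comm]
    refine mul_le_mul (Real.exp_le_exp.2 (by nlinarith)) ?_ (by positivity) (Real.exp_pos _).le
    rw [← Real.rpow_natCast]
    have := rpow_le_besselSymbol (s := 2 * k) (by positivity) hx
    rwa [mul_div_cancel_left₀ _ (two_ne_zero)] at this
  have h2 : besselSymbol (2 * k) x = besselSymbol (k + 1) x * besselSymbol (k - 1) x := by
    rw [besselSymbol_mul _ _ hx]; congr 1; ring
  rw [h2, ← mul_assoc] at h1
  refine h1.trans (mul_le_mul_of_nonneg_right ((le_abs_self _).trans (hM x hx))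
    (besselSymbol_pos _ hx).le)

/-- Away from `x = 0` a factor 1 is at most `5x`, and this spare power of `x` buys the additional
decay. The condition `t ≥ 1` gives `t ≥ (1 + t)/2`, turning `e^{-tx}` into a heat factor at time `1
+ t`. -/
theorem exists_abs_rpow_mul_heatDeriv_le (k : ℕ) {s : ℝ} (hs : 0 ≤ s) :
    ∃ C : ℝ, 0 < C ∧ ∀ t x : ℝ, 1 ≤ t → 21 / 100 < x →
      |x ^ (s / 2) * heatDeriv k t x| ≤
        C * (1 + t) ^ (-(k + s / 2 + 1)) * Real.exp (-(1 / 4 * (1 + t) * x)) := by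
  obtain ⟨C, hC, h⟩ := exists_rpow_le_mul_rpow_neg_mul_exp (p := k + s / 2 + 1) (by positivity)
    (ε := 1 / 4) (by norm_num)
  refine ⟨5 * C, by positivity, fun t x ht hx => ?_⟩
  have hx0 : 0 < x := by linarith
  have h1 := h (1 + t) x (by linarith) hx0
  have h2 : |x ^ (s / 2) * heatDeriv k t x| = x ^ (k + s / 2) * Real.exp (-(t * x)) := by
    rw [heatDeriv, abs_mul, abs_mul, abs_pow, abs_neg, abs_of_pos hx0, Real.abs_exp,
      abs_of_nonneg (by positivity), Real.rpow_add hx0, Real.rpow_natCast]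
    ring
  have h3 : x ^ (k + s / 2) ≤ 5 * x ^ (k + s / 2 + 1) := by
    rw [Real.rpow_add hx0 (k + s / 2), Real.rpow_one]
    nlinarith [Real.rpow_pos_of_pos hx0 (k + s / 2)]
  have h4 : Real.exp (-(t * x)) ≤ Real.exp (-(1 / 2 * ((1 + t) * x))) :=
    Real.exp_le_exp.2 (by nlinarith)
  have h5 : Real.exp (1 / 4 * ((1 + t) * x)) * Real.exp (-(1 / 2 * ((1 + t) * x))) =
      Real.exp (-(1 / 4 * (1 + t) * x)) := by
    rw [← Real.exp_add]; congr 1; ring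
  rw [h2]
  calc _ ≤ (5 * (C * (1 + t) ^ (-(k + s / 2 + 1)) * Real.exp (1 / 4 * ((1 + t) * x)))) *
        Real.exp (-(1 / 2 * ((1 + t) * x))) := by
        refine mul_le_mul (h3.trans (by gcongr)) h4 (Real.exp_pos _).le (by positivity)
    _ = 5 * C * (1 + t) ^ (-(k + s / 2 + 1)) *
        (Real.exp (1 / 4 * ((1 + t) * x)) * Real.exp (-(1 / 2 * ((1 + t) * x)))) := by ring
    _ = _ := by rw [h5]

theorem symbolBounds_solution {k : ℕ} (hk : k = 0 ∨ k = 1) {s : ℝ} (hs : 0 ≤ s) :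
    SymbolBounds (solutionSymbol s) (fun t x => x ^ (s / 2) * dampedDeriv k t x)
      (fun t x => if x ≤ 21 / 100 then x ^ (s / 2) * dampedDeriv k t x else 0)
      (fun t x => if x ≤ 21 / 100 then 0 else x ^ (s / 2) * dampedDeriv k t x) k (Set.Ioi 0)
      (k + s - 1) (k + s / 2) where
  pos_of_mem t ht := ht
  measurable t := by
    have := measurable_dampedSymbol t
    unfold solutionSymbol
    fun_prop
  measurable_deriv t := by
    have := measurable_dampedDeriv k t
    fun_prop
  measurable_lo t := by
    have := measurable_dampedDeriv k t
    exact Measurable.ite measurableSet_Iic (by fun_prop) (by fun_prop)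
  measurable_hi t := by
    have := measurable_dampedDeriv k t
    exact Measurable.ite measurableSet_Iic (by fun_prop) (by fun_prop)
  exists_bound t ht := by
    obtain ⟨M, hM⟩ := exists_abs_dampedDeriv_le (k := 0) (Or.inl rfl)
    refine ⟨|M|, fun x hx => ?_⟩
    have h1 := hM t x ht hx
    rw [dampedDeriv, if_pos rfl] at h1
    have h2 : |dampedSymbol t x| ≤ |M| * besselSymbol (k - 1) x := h1.trans
      (mul_le_mul (le_abs_self M) (besselSymbol_mono (by simp) hx) (besselSymbol_pos _ hx).le
        (abs_nonneg M))
    have h3 := abs_rpow_mul_le_besselSymbol hs hx h2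
    rwa [show (k : ℝ) - 1 + s = k + s - 1 by ring] at h3
  exists_deriv_bound δ hδ := by
    obtain ⟨M, hM⟩ := exists_abs_dampedDeriv_le hk
    refine ⟨M, fun t ht x hx => ?_⟩
    have h3 := abs_rpow_mul_le_besselSymbol hs hx (hM t x (by linarith) hx)
    rwa [show (k : ℝ) - 1 + s = k + s - 1 by ring] at h3
  deriv_eq := by
    rcases hk with rfl | rfl
    · left
      refine ⟨rfl, ?_⟩
      ext t x
      rw [dampedDeriv, if_pos rfl, solutionSymbol]
    · right
      refine ⟨rfl, fun t _ x _ => ?_⟩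
      simp only [solutionSymbol, dampedDeriv, one_ne_zero, if_false]
      exact (hasDerivAt_dampedSymbol t x).const_mul _
  eq_add t _ x _ := by split_ifs <;> simp
  exists_lo_bound := by
    obtain ⟨C, hC, h⟩ := exists_low_bound k hs
    refine ⟨C, 1 / 4, hC, by norm_num, fun t ht x hx => ?_⟩
    have ht0 : (0 : ℝ) < t := ht
    split_ifs with hx1
    · exact h t x _ ht0 hx hx1 (abs_dampedDeriv_le_of_le hk ht0 hx hx1)
    · rw [abs_zero]; positivity
  exists_hi_bound := by
    refine ⟨100, by norm_num, fun t ht x hx => ?_⟩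
    split_ifs with hx1
    · rw [abs_zero]
      exact mul_nonneg (by positivity) (besselSymbol_pos _ hx).le
    · have h3 := abs_rpow_mul_le_besselSymbol hs hx
        (abs_dampedDeriv_le_of_lt hk ht (not_le.1 hx1))
      rwa [show (k : ℝ) - 1 + s = k + s - 1 by ring] at h3

/-- Above the cut the heat symbol is kept in the low part: just above `21/100` it decays more slowly
than `e^{-t/4}` and cannot be charged to the Sobolev norm, whereas the `L^q` smoothing of the
semigroup controls it. -/
theorem symbolBounds_difference {k : ℕ} (hk : k = 0 ∨ k = 1) {s : ℝ} (hs : 0 ≤ s) :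
    SymbolBounds (differenceSymbol s)
      (fun t x => x ^ (s / 2) * (dampedDeriv k t x - heatDeriv k t x))
      (fun t x => if x ≤ 21 / 100 then x ^ (s / 2) * (dampedDeriv k t x - heatDeriv k t x)
        else -(x ^ (s / 2) * heatDeriv k t x))
      (fun t x => if x ≤ 21 / 100 then 0 else x ^ (s / 2) * dampedDeriv k t x) k (Set.Ici 1)
      (k + s - 1) (k + s / 2 + 1) where
  pos_of_mem t ht := lt_of_lt_of_le one_pos ht
  measurable t := by
    have := measurable_dampedSymbol t
    unfold differenceSymbol
    fun_prop
  measurable_deriv t := by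
    have := measurable_dampedDeriv k t
    have := measurable_heatDeriv k t
    fun_prop
  measurable_lo t := by
    have := measurable_dampedDeriv k t
    have := measurable_heatDeriv k t
    exact Measurable.ite measurableSet_Iic (by fun_prop) (by fun_prop)
  measurable_hi t := by
    have := measurable_dampedDeriv k t
    exact Measurable.ite measurableSet_Iic (by fun_prop) (by fun_prop)
  exists_bound t ht := by
    obtain ⟨M, hM⟩ := exists_abs_dampedDeriv_le (k := 0) (Or.inl rfl)
    obtain ⟨M', hM'⟩ := exists_abs_heatDeriv_le 0 ht
    refine ⟨|M + M'|, fun x hx => ?_⟩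
    have h1 := (abs_sub (dampedDeriv 0 t x) (heatDeriv 0 t x)).trans
      (add_le_add (hM t x ht hx) (hM' t x le_rfl hx))
    rw [dampedDeriv, if_pos rfl, heatDeriv, pow_zero, one_mul, ← add_mul] at h1
    have h2 : |dampedSymbol t x - Real.exp (-(t * x))| ≤ |M + M'| * besselSymbol (k - 1) x :=
      h1.trans (mul_le_mul (le_abs_self _) (besselSymbol_mono (by simp) hx)
        (besselSymbol_pos _ hx).le (abs_nonneg _))
    have h3 := abs_rpow_mul_le_besselSymbol hs hx h2
    rwa [show (k : ℝ) - 1 + s = k + s - 1 by ring] at h3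
  exists_deriv_bound δ hδ := by
    obtain ⟨M, hM⟩ := exists_abs_dampedDeriv_le hk
    obtain ⟨M', hM'⟩ := exists_abs_heatDeriv_le k hδ
    refine ⟨M + M', fun t ht x hx => ?_⟩
    have h1 := (abs_sub (dampedDeriv k t x) (heatDeriv k t x)).trans
      (add_le_add (hM t x (by linarith) hx) (hM' t x ht hx))
    rw [← add_mul] at h1
    have h3 := abs_rpow_mul_le_besselSymbol hs hx h1
    rwa [show (k : ℝ) - 1 + s = k + s - 1 by ring] at h3
  deriv_eq := by
    rcases hk with rfl | rfl
    · left
      refine ⟨rfl, ?_⟩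
      ext t x
      rw [dampedDeriv, if_pos rfl, differenceSymbol, heatDeriv, pow_zero, one_mul]
    · right
      refine ⟨rfl, fun t _ x _ => ?_⟩
      simp only [differenceSymbol, dampedDeriv, one_ne_zero, if_false]
      have hexp : HasDerivAt (fun t : ℝ => Real.exp (-(t * x))) (heatDeriv 1 t x) t := by
        refine (((hasDerivAt_id t).mul_const x).neg.exp).congr_deriv ?_
        simp only [heatDeriv, id_eq, Pi.neg_apply]
        ring
      exact ((hasDerivAt_dampedSymbol t x).sub hexp).const_mul _
  eq_add t _ x _ := by split_ifs <;> ring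
  exists_lo_bound := by
    obtain ⟨C, hC, h⟩ := exists_low_bound (k + 1) hs
    obtain ⟨C', hC', h'⟩ := exists_abs_rpow_mul_heatDeriv_le k hs
    refine ⟨C + C', 1 / 4, by positivity, by norm_num, fun t ht x hx => ?_⟩
    have ht1 : (1 : ℝ) ≤ t := ht
    have ht0 : 0 < t := by linarith
    split_ifs with hx1
    · refine (h t x _ ht0 hx hx1 (abs_dampedDeriv_sub_heatDeriv_le hk ht0 hx hx1)).trans ?_
      rw [show ((k + 1 : ℕ) : ℝ) + s / 2 = k + s / 2 + 1 by push_cast; ring]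
      gcongr
      linarith
    · rw [abs_neg]
      refine (h' t x ht1 (not_le.1 hx1)).trans ?_
      gcongr
      linarith
  exists_hi_bound := by
    refine ⟨100, by norm_num, fun t ht x hx => ?_⟩
    have ht0 : 0 < t := lt_of_lt_of_le one_pos ht
    split_ifs with hx1
    · rw [abs_zero]
      exact mul_nonneg (by positivity) (besselSymbol_pos _ hx).le
    · have h3 := abs_rpow_mul_le_besselSymbol hs hx
        (abs_dampedDeriv_le_of_lt hk ht0 (not_le.1 hx1))
      rwa [show (k : ℝ) - 1 + s = k + s - 1 by ring] at h3

end

/-- Self-adjointness and nonnegativity of `A` only enter through the existence of its resolution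
and the position of the spectrum; the heat kernel decay already confines the resolution to
`(0, ∞)`, see `SpectralMeasure.HeatBound.isPositive`. -/
theorem mainTheorem1 {X 𝕜 : Type*} [RCLike 𝕜] [MeasurableSpace X] (μ : Measure X) [SigmaFinite μ]
    (A : Lp 𝕜 2 μ →ₗ.[𝕜] Lp 𝕜 2 μ) (hA : IsSelfAdjoint A)
    (hA_nonneg : ∀ f : A.domain, 0 ≤ RCLike.re (inner 𝕜 (A f) (f : Lp 𝕜 2 μ)))
    (α : ℝ) (hα : 0 < α) (hdecay : HeatDecay A α)
    (k : ℕ) (hk : k = 0 ∨ k = 1) (q : ℝ) (hq : 1 ≤ q ∧ q ≤ 2) (s : ℝ) (hs : 0 ≤ s)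
    (β : ℝ) (hβ : 2 * α + k + s - 1 < β) :
    -- Matsumura type estimates
    (DecayEstimate A (solutionSymbol s) k ⊤ (ENNReal.ofReal q) β
        (2 * α / q + k + s / 2) (Set.Ioi 0) ∧
      DecayEstimate A (solutionSymbol s) k 2 (ENNReal.ofReal q) (k + s - 1)
        (2 * α * (1 / q - 1 / 2) + k + s / 2) (Set.Ioi 0)) ∧
    -- asymptotic behaviour
    (DecayEstimate A (differenceSymbol s) k ⊤ (ENNReal.ofReal q) β
        (2 * α / q + k + s / 2 + 1) (Set.Ici 1) ∧
      DecayEstimate A (differenceSymbol s) k 2 (ENNReal.ofReal q) (k + s - 1)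
        (2 * α * (1 / q - 1 / 2) + k + s / 2 + 1) (Set.Ici 1)) := by
  have hS := symbolBounds_solution hk hs
  have hD := symbolBounds_difference hk hs
  have hρ : 0 ≤ (k : ℝ) + s / 2 := by positivity
  have hρ' : 0 ≤ (k : ℝ) + s / 2 + 1 := by positivity
  have hβ' : 2 * α + (k + s - 1) < β := by linarith
  refine ⟨⟨?_, ?_⟩, ?_, ?_⟩
  · convert hS.decayEstimate_top hρ hα hdecay hq.1 hq.2 hβ' using 1
    ring
  · convert hS.decayEstimate_two hρ hα hdecay hq.1 hq.2 using 1
    ring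
  · convert hD.decayEstimate_top hρ' hα hdecay hq.1 hq.2 hβ' using 1
    ring
  · convert hD.decayEstimate_two hρ' hα hdecay hq.1 hq.2 using 1
    ring
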